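/- Let $B\subset\mathbb{R}^3$ be an (open, solid) ellipsoid centered at the origin, i.e. $B=\{x:\sum_{i=1}^3 (b_i\cdot x)^2/a_i^2<1\}$ for some orthonormal basis $(b_1,b_2,b_3)$ of $\mathbb{R}^3$ and some semi-axes $a_1,a_2,a_3>0$. Let $G^0(x,y)=\frac{1}{4\pi|x-y|}$, and let $\mathcal{T}_B^0:L^2(B,\mathbb{R}^3)\to L^2(B,\mathbb{R}^3)$ be the static magnetization operator $$\mathcal{T}_B^0[f]=-\nabla\int_B \nabla_x G^0(\cdot,y)\cdot f(y)\,dy ,$$ where the outer gradient is the weak gradient on $B$. For $x\in B$ let $\mathbf{L}_B(x)$ be the real $3\times 3$ matrix $$\mathbf{L}_B(x)=\int_{\partial B}\nabla_x G^0(x,y)\,\boldsymbol\nu(y)^{\top}\,d\sigma(y),$$ where $\boldsymbol\nu$ is the outward unit normal and $\sigma$ is the surface measure on $\partial B$. Then the following hold. 1. The matrix $\mathbf{L}_B(x)$ does not depend on $x\in B$; write $\mathbf{L}_B$ for it. 2. Let $\varphi\in L^2(B,\mathbb{R}^3)$ and $\lambda\in\mathbb{R}\setminus\{0,1\}$ satisfy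 $\lambda\varphi-\mathcal{T}_B^0[\varphi]=0$ and $\int_B\varphi\neq 0$. Then $(\lambda I-\mathbf{L}_B)\int_B\varphi=0$. 3. Conversely, let $\mathbf{E}\in\mathbb{R}^3\setminus\{0\}$ and $\lambda\in\mathbb{R}$ satisfy $\mathbf{L}_B\mathbf{E}=\lambda\mathbf{E}$. Then the constant field $\mathbf{E}$ on $B$ satisfies $\mathcal{T}_B^0[\mathbf{E}]=\lambda\mathbf{E}$. -/

import Mathlib

open MeasureTheory Topology
open scoped ContDiff RealInnerProductSpace

/-- Three-dimensional Euclidean space. -/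
abbrev E3 : Type := EuclideanSpace ℝ (Fin 3)

/-- The static Green function `G⁰(x, y) = 1 / (4π |x - y|)`. -/
noncomputable def staticGreen (x y : E3) : ℝ := 1 / (4 * Real.pi * ‖x - y‖)

/-- The gradient `∇ₓ G⁰(x, y)` with respect to the first variable. -/
noncomputable def gradGreen (x y : E3) : E3 := gradient (fun z => staticGreen z y) x

/-- The vector field `g` is the weak gradient of the scalar function `u` on the open set `D`. -/
def HasWeakGradientOn (D : Set E3) (u : E3 → ℝ) (g : E3 → E3) : Prop :=
  LocallyIntegrableOn u D volume ∧ LocallyIntegrableOn g D volume ∧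
    ∀ ψ : E3 → ℝ, ContDiff ℝ ∞ ψ → HasCompactSupport ψ → tsupport ψ ⊆ D →
      ∫ x in D, u x • gradient ψ x = -∫ x in D, ψ x • g x

/-- The potential `x ↦ ∫_D ∇ₓ G⁰(x, y) · f(y) dy`. -/
noncomputable def staticPotential (D : Set E3) (f : E3 → E3) (x : E3) : ℝ :=
  ∫ y in D, ⟪gradGreen x y, f y⟫

/-- `g = 𝒯_D⁰[f]`, where `𝒯_D⁰ : L²(D, ℝ³) → L²(D, ℝ³)` is the static magnetization operator
`𝒯_D⁰[f] = -∇ ∫_D ∇ₓ G⁰(·, y) · f(y) dy`, the outer gradient being the weak gradient on `D`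
(so that `g` is determined by `f` up to equality almost everywhere on `D`). -/
def IsStaticMagnetization (D : Set E3) (f g : E3 → E3) : Prop :=
  MemLp f 2 (volume.restrict D) ∧ MemLp g 2 (volume.restrict D) ∧
    HasWeakGradientOn D (staticPotential D f) (fun x => -g x)

/-- The image under `𝒯_D⁰` is unique almost everywhere on the open set `D`. -/
theorem IsStaticMagnetization.ae_eq {D : Set E3} (hD : IsOpen D) {f g h : E3 → E3}
    (hg : IsStaticMagnetization D f g) (hh : IsStaticMagnetization D f h) :
    g =ᵐ[volume.restrict D] h := by
  have hsub : LocallyIntegrableOn (fun x => g x - h x) D volume := by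
    have h1 := hh.2.2.2.1.sub hg.2.2.2.1
    refine h1.congr (Filter.Eventually.of_forall fun x => ?_)
    simp only [Pi.sub_apply]
    abel
  have hD' := hD.measurableSet
  have key := hD.ae_eq_zero_of_integral_contDiff_smul_eq_zero hsub (by
    intro ψ h1 h2 h3
    have e1 := hg.2.2.2.2 ψ h1 h2 h3
    have e2 := hh.2.2.2.2 ψ h1 h2 h3
    rw [e1] at e2
    have hz : ∀ x, x ∉ D → ψ x • (g x - h x) = 0 := by
      intro x hx
      rw [image_eq_zero_of_notMem_tsupport (fun hx' => hx (h3 hx')), zero_smul]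
    have hψ : MemLp ψ 2 (volume.restrict D) :=
      (h1.continuous.memLp_of_hasCompactSupport h2).restrict D
    have hint : ∀ k : E3 → E3, MemLp k 2 (volume.restrict D) →
        IntegrableOn (fun x => ψ x • (-k x)) D volume := fun k hk =>
      memLp_one_iff_integrable.mp (hk.neg.smul hψ)
    have i1 := hint g hg.2.1
    have i2 := hint h hh.2.1
    rw [← setIntegral_eq_integral_of_forall_compl_eq_zero hz]
    have e3 : ∫ x in D, ψ x • (-h x) - ψ x • (-g x) = 0 := by
      rw [integral_sub i2 i1]
      rw [neg_inj] at e2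
      rw [e2, sub_self]
    rw [← e3]
    refine integral_congr_ae (Filter.Eventually.of_forall fun x => ?_)
    simp only [smul_neg, smul_sub]
    abel)
  refine (ae_restrict_iff' hD').mpr ?_
  filter_upwards [key] with x hx hxD
  exact sub_eq_zero.mp (hx hxD)

/-- `n` is the outward unit normal to `D` at `y`: near `y`, the set `D` agrees to first order with
the half-space `{z | ⟪z - y, n⟫ < 0}`. -/
def IsOutwardUnitNormal (D : Set E3) (y n : E3) : Prop :=
  ‖n‖ = 1 ∧ ∀ ε : ℝ, 0 < ε → ∀ᶠ z in 𝓝 y,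
    (z ∈ D → ⟪z - y, n⟫ ≤ ε * ‖z - y‖) ∧ (z ∉ D → -(ε * ‖z - y‖) ≤ ⟪z - y, n⟫)

/-- The outward unit normal is unique. -/
theorem IsOutwardUnitNormal.unique {D : Set E3} {y n m : E3}
    (hn : IsOutwardUnitNormal D y n) (hm : IsOutwardUnitNormal D y m) : n = m := by
  by_contra hne
  have hc : ⟪n, m⟫ < 1 := (inner_lt_one_iff_real_of_norm_eq_one hn.1 hm.1).mpr hne
  have hnn : ⟪n, n⟫ = 1 := by rw [real_inner_self_eq_norm_sq, hn.1, one_pow]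
  have hmm : ⟪m, m⟫ = 1 := by rw [real_inner_self_eq_norm_sq, hm.1, one_pow]
  have hv : 0 < ‖m - n‖ := norm_pos_iff.mpr (sub_ne_zero.mpr (Ne.symm hne))
  have hε : 0 < (1 - ⟪n, m⟫) / (2 * ‖m - n‖) := div_pos (by linarith) (by linarith)
  have hεv : (1 - ⟪n, m⟫) / (2 * ‖m - n‖) * ‖m - n‖ = (1 - ⟪n, m⟫) / 2 := by
    field_simp
  have ht : Filter.Tendsto (fun t : ℝ => y + t • (m - n)) (𝓝[>] 0) (𝓝 y) := by
    have hcont : Continuous (fun t : ℝ => y + t • (m - n)) := by fun_prop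
    have h0 := hcont.tendsto 0
    simp only [zero_smul, add_zero] at h0
    exact h0.mono_left nhdsWithin_le_nhds
  obtain ⟨t, ⟨h1, h2⟩, htpos⟩ :=
    ((ht.eventually ((hn.2 _ hε).and (hm.2 _ hε))).and self_mem_nhdsWithin).exists
  have htpos' : 0 < t := htpos
  simp only [add_sub_cancel_left, inner_smul_left, inner_sub_left, norm_smul, Real.norm_eq_abs,
    abs_of_pos htpos', RCLike.conj_to_real, hnn, hmm, real_inner_comm n m] at h1 h2
  by_cases hz : y + t • (m - n) ∈ D
  · have := h2.1 hz
    nlinarith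
  · have := h1.2 hz
    nlinarith

open Classical in
/-- The outward unit normal `ν(y)` of `D` at a boundary point `y` (zero if there is none). -/
noncomputable def outwardUnitNormal (D : Set E3) (y : E3) : E3 :=
  if h : ∃ n, IsOutwardUnitNormal D y n then h.choose else 0

/-- The matrix `L_D(x) = ∫_{∂D} ∇ₓ G⁰(x, y) ν(y)ᵀ dσ(y)`, where `σ` is the surface measure, that is
the two-dimensional Hausdorff measure normalized to agree with the area on planes. -/
noncomputable def dyadicL (D : Set E3) (x : E3) : Matrix (Fin 3) (Fin 3) ℝ :=
  Matrix.of fun i j => ∫ y in frontier D, gradGreen x y i * outwardUnitNormal D y j ∂μHE[2]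

/-- `B` is a (solid, open) ellipsoid centered at the origin, with arbitrary principal axes
`b 0, b 1, b 2` and semi-axes `a 0, a 1, a 2 > 0`. -/
def IsCenteredEllipsoid (B : Set E3) : Prop :=
  ∃ (b : OrthonormalBasis (Fin 3) ℝ E3) (a : Fin 3 → ℝ), (∀ i, 0 < a i) ∧
    B = {x : E3 | ∑ i, (⟪b i, x⟫ / a i) ^ 2 < 1}

/-! All three claims are read off from one linear map, `demag A`, an average over directions θ
attached to the quadratic form ⟪A x, x⟫ of the ellipsoid.

Newton's theorem (`integral_newtonField_mul`). In polar coordinates about an interior point y the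
Jacobian r² cancels the kernel, so the field at y is an average of θ weighted by the length of the
ellipsoid seen in direction θ. Pairing θ with -θ leaves the difference of two opposite lengths,
which is -2⟪A y, θ⟫ / ⟪A θ, θ⟫ by completing the square, hence linear in y. So a constant field E
has potential -⟪demag A x, E⟫ in the ellipsoid. Reflections in the principal planes show that `demag
A` is diagonal, hence symmetric; the potential therefore has gradient -`demag A E`, and eigenvectors
of `demag A` give constant eigenfields.

Means of eigenfields (`demag_integral_of_isStaticMagnetization`). The equation is tested with a
cut-off ψ = η(⟪A x, x⟫) with a boundary layer of width ε. Fubini pairs φ with the Newtonian field W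
of ∂_E ψ, and differentiating Newton's theorem gives W = `demag A E` inside the layer's inner
boundary. In the layer, W = O(ε^(-1/2)), because ∂_E ψ = O(1/ε) while every ray meets the layer in
length O(√ε). The layer has volume O(ε) and φ is square integrable, so the error tends to 0.

The surface matrix (`toEuclideanLin_dyadicL`). By `map_toSphere_rayLength` the solid angle seen from
x is a weighted surface measure; this is proved by comparing small pieces of the surface with cones
over their tangent planes. The surface integral becomes an integral over directions, where antipodal
averaging removes x and leaves the matrix of `demag A`. -/

/-! ### Polar coordinates and symmetries of the unit sphere -/

open Set Metric in
/-- Polar coordinates for the Lebesgue integral on `ℝ³`. -/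
theorem lintegral_polar (f : E3 → ENNReal) (hf : Measurable f) :
    ∫⁻ z, f z = ∫⁻ θ : sphere (0 : E3) 1, ∫⁻ r in Ioi (0 : ℝ),
      ENNReal.ofReal (r ^ 2) * f (r • (θ : E3)) ∂volume ∂(volume : Measure E3).toSphere := by
  have hmp := (volume : Measure E3).measurePreserving_homeomorphUnitSphereProd
  have hdim : Module.finrank ℝ E3 - 1 = 2 := by simp
  rw [hdim] at hmp
  have hsm : Measurable (fun p : sphere (0 : E3) 1 × Ioi (0 : ℝ) => f ((p.2 : ℝ) • (p.1 : E3))) :=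
    hf.comp (by fun_prop)
  calc ∫⁻ z, f z = ∫⁻ z : ({(0 : E3)}ᶜ : Set E3), f z ∂(volume.comap Subtype.val) := by
        rw [lintegral_subtype_comap (measurableSet_singleton _).compl, restrict_compl_singleton]
    _ = ∫⁻ z : ({(0 : E3)}ᶜ : Set E3), (fun p : sphere (0 : E3) 1 × Ioi (0 : ℝ) =>
          f ((p.2 : ℝ) • (p.1 : E3))) (homeomorphUnitSphereProd E3 z) ∂(volume.comap Subtype.val) := by
        refine lintegral_congr fun z => ?_
        have hz : ‖(z : E3)‖ ≠ 0 := norm_ne_zero_iff.mpr z.2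
        simp [smul_smul, hz]
    _ = ∫⁻ p, f ((p.2 : ℝ) • (p.1 : E3))
          ∂((volume : Measure E3).toSphere.prod (Measure.volumeIoiPow 2)) :=
        hmp.lintegral_comp_emb (Homeomorph.measurableEmbedding _)
          (fun p : sphere (0 : E3) 1 × Ioi (0 : ℝ) => f ((p.2 : ℝ) • (p.1 : E3)))
    _ = _ := by
        rw [lintegral_prod _ hsm.aemeasurable]
        refine lintegral_congr fun θ => ?_
        rw [Measure.volumeIoiPow, lintegral_withDensity_eq_lintegral_mul]
        · simp only [Pi.mul_apply]
          rw [lintegral_subtype_comap measurableSet_Ioi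
            (fun r : ℝ => ENNReal.ofReal (r ^ 2) * f (r • (θ : E3)))]
        · fun_prop
        · exact hsm.comp (by fun_prop)

open Set Metric in
/-- Polar coordinates for the Bochner integral on `ℝ³`, together with integrability over the
sphere of the radial integrals. -/
theorem integral_polar {F : Type*} [NormedAddCommGroup F] [NormedSpace ℝ F]
    (f : E3 → F) (hf : Integrable f) :
    Integrable (fun θ : sphere (0 : E3) 1 => ∫ r in Ioi (0 : ℝ), r ^ 2 • f (r • (θ : E3)))
      (volume : Measure E3).toSphere ∧
    ∫ z, f z = ∫ θ : sphere (0 : E3) 1, ∫ r in Ioi (0 : ℝ),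
      r ^ 2 • f (r • (θ : E3)) ∂volume ∂(volume : Measure E3).toSphere := by
  have hmp := (volume : Measure E3).measurePreserving_homeomorphUnitSphereProd
  have hdim : Module.finrank ℝ E3 - 1 = 2 := by simp
  rw [hdim] at hmp
  set g : sphere (0 : E3) 1 × Ioi (0 : ℝ) → F := fun p => f ((p.2 : ℝ) • (p.1 : E3)) with hg
  have hcomp : ∀ z : ({(0 : E3)}ᶜ : Set E3), f z = g (homeomorphUnitSphereProd E3 z) := by
    intro z
    have hz : ‖(z : E3)‖ ≠ 0 := norm_ne_zero_iff.mpr z.2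
    simp [hg, smul_smul, hz]
  have hint : Integrable g ((volume : Measure E3).toSphere.prod (Measure.volumeIoiPow 2)) := by
    rw [← hmp.integrable_comp_emb (Homeomorph.measurableEmbedding _)]
    have h1 : IntegrableOn f ({(0 : E3)}ᶜ : Set E3) := hf.integrableOn
    rw [integrableOn_iff_comap_subtypeVal (measurableSet_singleton _).compl] at h1
    exact h1.congr (Filter.Eventually.of_forall hcomp)
  have hinner : ∀ θ : sphere (0 : E3) 1, ∫ r, g (θ, r) ∂(Measure.volumeIoiPow 2) =
      ∫ r in Ioi (0 : ℝ), r ^ 2 • f (r • (θ : E3)) := by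
    intro θ
    have hm : Measurable fun r : Ioi (0 : ℝ) => ((r : ℝ) ^ 2).toNNReal :=
      (measurable_subtype_coe.pow_const _).real_toNNReal
    have : Measure.volumeIoiPow 2 = (Measure.comap Subtype.val volume).withDensity
        (fun r : Ioi (0 : ℝ) => (((r : ℝ) ^ 2).toNNReal : ENNReal)) := rfl
    rw [this, integral_withDensity_eq_integral_smul hm,
      integral_subtype_comap measurableSet_Ioi fun r : ℝ => (r ^ 2).toNNReal • f (r • (θ : E3))]
    refine setIntegral_congr_fun measurableSet_Ioi fun r hr => ?_
    simp only [NNReal.smul_def, Real.coe_toNNReal _ (sq_nonneg r)]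
  constructor
  · exact hint.integral_prod_left.congr (Filter.Eventually.of_forall hinner)
  · calc ∫ z, f z = ∫ z : ({(0 : E3)}ᶜ : Set E3), f z ∂(volume.comap Subtype.val) := by
          rw [integral_subtype_comap (measurableSet_singleton _).compl, restrict_compl_singleton]
      _ = ∫ z : ({(0 : E3)}ᶜ : Set E3), g (homeomorphUnitSphereProd E3 z)
            ∂(volume.comap Subtype.val) := integral_congr_ae (Filter.Eventually.of_forall hcomp)
      _ = ∫ p, g p ∂((volume : Measure E3).toSphere.prod (Measure.volumeIoiPow 2)) :=
          hmp.integral_comp (Homeomorph.measurableEmbedding _) g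
      _ = _ := by
          rw [integral_prod _ hint]
          exact integral_congr_ae (Filter.Eventually.of_forall hinner)

open Set Metric Pointwise in
/-- The surface measure of the unit sphere is invariant under linear isometries. -/
theorem map_toSphere_linearIsometryEquiv (e : E3 ≃ₗᵢ[ℝ] E3) :
    Measure.map (fun θ : sphere (0 : E3) 1 => e (θ : E3)) (volume : Measure E3).toSphere =
      Measure.map Subtype.val (volume : Measure E3).toSphere := by
  ext T hT
  have hm : Measurable fun θ : sphere (0 : E3) 1 => e (θ : E3) :=
    e.continuous.measurable.comp measurable_subtype_coe
  -- The surface measure of a set is 3 times the volume of the cone over it, and a linear isometry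
  -- maps cones to cones of equal volume.
  rw [Measure.map_apply hm hT, Measure.map_apply measurable_subtype_coe hT,
    Measure.toSphere_apply' _ (hm hT), Measure.toSphere_apply' _ (measurable_subtype_coe hT)]
  congr 1
  rw [← e.measurePreserving.measure_preimage_equiv
    (f := e.toHomeomorph.toMeasurableEquiv) (Ioo (0 : ℝ) 1 • (Subtype.val '' (Subtype.val ⁻¹' T)))]
  congr 1
  ext z
  simp only [Set.mem_smul, Set.mem_image, Set.mem_preimage, Subtype.exists, mem_sphere_zero_iff_norm,
    exists_and_left, exists_prop, exists_eq_right_right]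
  constructor
  · rintro ⟨t, ht, w, ⟨h1, h2⟩, rfl⟩
    exact ⟨t, ht, e w, ⟨h1, by simpa using h2⟩, by simp⟩
  · rintro ⟨t, ht, w, ⟨h1, h2⟩, h3⟩
    refine ⟨t, ht, e.symm w, ⟨by simpa using h1, by simpa using h2⟩, ?_⟩
    rw [← map_smul, h3]; simp

open Set Metric in
theorem integral_sphere_comp_linearIsometryEquiv {F : Type*} [NormedAddCommGroup F]
    [NormedSpace ℝ F] (e : E3 ≃ₗᵢ[ℝ] E3) (f : E3 → F) :
    ∫ θ : sphere (0 : E3) 1, f (e θ) ∂(volume : Measure E3).toSphere =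
      ∫ θ : sphere (0 : E3) 1, f θ ∂(volume : Measure E3).toSphere := by
  have h1 : MeasurableEmbedding (Subtype.val : sphere (0 : E3) 1 → E3) :=
    MeasurableEmbedding.subtype_coe isClosed_sphere.measurableSet
  have h2 : MeasurableEmbedding (fun θ : sphere (0 : E3) 1 => e (θ : E3)) :=
    e.toHomeomorph.measurableEmbedding.comp h1
  rw [← h2.integral_map, ← h1.integral_map, map_toSphere_linearIsometryEquiv]

open Set Metric in
theorem integral_sphere_neg {F : Type*} [NormedAddCommGroup F]
    [NormedSpace ℝ F] (f : E3 → F) :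
    ∫ θ : sphere (0 : E3) 1, f (-(θ : E3)) ∂(volume : Measure E3).toSphere =
      ∫ θ : sphere (0 : E3) 1, f θ ∂(volume : Measure E3).toSphere :=
  integral_sphere_comp_linearIsometryEquiv (LinearIsometryEquiv.neg ℝ) f

open Set Metric in
theorem integrable_sphere_neg {F : Type*} [NormedAddCommGroup F]
    (f : E3 → F)
    (hf : Integrable (fun θ : sphere (0 : E3) 1 => f θ) (volume : Measure E3).toSphere) :
    Integrable (fun θ : sphere (0 : E3) 1 => f (-(θ : E3))) (volume : Measure E3).toSphere := by
  have h1 : MeasurableEmbedding (Subtype.val : sphere (0 : E3) 1 → E3) :=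
    MeasurableEmbedding.subtype_coe isClosed_sphere.measurableSet
  have h2 : MeasurableEmbedding
      (fun θ : sphere (0 : E3) 1 => LinearIsometryEquiv.neg ℝ (θ : E3)) :=
    (LinearIsometryEquiv.neg ℝ : E3 ≃ₗᵢ[ℝ] E3).toHomeomorph.measurableEmbedding.comp h1
  have h3 := (h1.integrable_map_iff (g := f)).mpr hf
  rw [← map_toSphere_linearIsometryEquiv (LinearIsometryEquiv.neg ℝ)] at h3
  exact h2.integrable_map_iff.mp h3

/-! ### The Newtonian kernel -/

/-- The gradient of the Newtonian kernel: `∇ₓ G⁰(x, y) = newtonField (x - y)`. -/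
noncomputable def newtonField (z : E3) : E3 := -((4 * Real.pi * ‖z‖ ^ 3)⁻¹ • z)

theorem newtonField_neg (z : E3) : newtonField (-z) = -newtonField z := by
  simp [newtonField]

theorem measurable_newtonField : Measurable newtonField := by
  unfold newtonField; fun_prop

theorem norm_newtonField (z : E3) : ‖newtonField z‖ = (4 * Real.pi)⁻¹ * (‖z‖ ^ 2)⁻¹ := by
  rw [newtonField, norm_neg, norm_smul, norm_inv, Real.norm_of_nonneg (by positivity)]
  rcases eq_or_ne ‖z‖ 0 with h | h
  · simp [h]
  · field_simp

/-- The polar Jacobian cancels the singularity exactly: this turns field integrals into averages of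
lengths along rays. -/
theorem sq_smul_newtonField_smul (θ : Metric.sphere (0 : E3) 1) {r : ℝ} (hr : 0 < r) :
    r ^ 2 • newtonField (r • (θ : E3)) = -((4 * Real.pi)⁻¹ • (θ : E3)) := by
  have : ‖(θ : E3)‖ = 1 := by simp
  rw [newtonField, norm_smul, this, Real.norm_of_nonneg hr.le, mul_one, smul_neg, smul_smul,
    smul_smul]
  congr 2
  field_simp

/-- On the diagonal both sides are the default value 0: the Green function blows up near x but
equals 1 / 0 = 0 at x, so it is not differentiable there. Off the diagonal the norm is
differentiated as the square root of its smooth square. -/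
theorem gradGreen_eq (x y : E3) : gradGreen x y = newtonField (x - y) := by
  rcases eq_or_ne x y with rfl | hne
  · have hnd : ¬ DifferentiableAt ℝ (fun z => staticGreen z x) x := by
      intro hd
      have hc : Filter.Tendsto (fun z => staticGreen z x) (𝓝[≠] x) (𝓝 0) := by
        have := hd.continuousAt.tendsto
        simp only [staticGreen, sub_self, norm_zero, mul_zero, div_zero] at this
        exact this.mono_left nhdsWithin_le_nhds
      have h0 : Filter.Tendsto (fun z : E3 => 4 * Real.pi * ‖z - x‖) (𝓝[≠] x) (𝓝[>] 0) := by
        refine tendsto_nhdsWithin_iff.mpr ⟨?_, ?_⟩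
        · have : Continuous (fun z : E3 => 4 * Real.pi * ‖z - x‖) := by fun_prop
          have := this.tendsto x
          simp only [sub_self, norm_zero, mul_zero] at this
          exact this.mono_left nhdsWithin_le_nhds
        · filter_upwards [self_mem_nhdsWithin] with z hz
          have : 0 < ‖z - x‖ := norm_pos_iff.mpr (sub_ne_zero.mpr hz)
          have := Real.pi_pos
          simp only [Set.mem_Ioi]; positivity
      have h1 : Filter.Tendsto (fun z => staticGreen z x) (𝓝[≠] x) Filter.atTop := by
        simp only [staticGreen, one_div]
        exact tendsto_inv_nhdsGT_zero.comp h0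
      exact not_tendsto_nhds_of_tendsto_atTop h1 0 hc
    rw [gradGreen, gradient_eq_zero_of_not_differentiableAt hnd]
    simp [newtonField]
  · rw [gradGreen]
    refine HasGradientAt.gradient ?_
    have hpos : ‖x - y‖ ≠ 0 := norm_ne_zero_iff.mpr (sub_ne_zero.mpr hne)
    have h1 : HasFDerivAt (fun z : E3 => ‖z - y‖ ^ 2) (2 • (innerSL ℝ (x - y))) x := by
      exact (hasStrictFDerivAt_norm_sq (x - y)).hasFDerivAt.comp x
        ((hasFDerivAt_id x).sub_const y)
    have h2 : HasDerivAt (fun s : ℝ => (4 * Real.pi * Real.sqrt s)⁻¹)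
        (-(4 * Real.pi * (1 / (2 * Real.sqrt (‖x - y‖ ^ 2)))) /
          (4 * Real.pi * Real.sqrt (‖x - y‖ ^ 2)) ^ 2) (‖x - y‖ ^ 2) := by
      refine ((Real.hasDerivAt_sqrt (by positivity)).const_mul (4 * Real.pi)).inv ?_
      rw [Real.sqrt_sq (norm_nonneg _)]
      have := Real.pi_pos
      positivity
    have h3 := h2.comp_hasFDerivAt x h1
    rw [hasGradientAt_iff_hasFDerivAt]
    have hfun : ((fun s : ℝ => (4 * Real.pi * Real.sqrt s)⁻¹) ∘ fun z : E3 => ‖z - y‖ ^ 2) =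
        fun z => staticGreen z y := by
      funext z
      simp [staticGreen, Real.sqrt_sq (norm_nonneg _)]
    rw [hfun] at h3
    refine h3.congr_fderiv ?_
    ext v
    rw [Real.sqrt_sq (norm_nonneg _)]
    simp only [newtonField, smul_apply, innerSL_apply_apply, map_neg,
      neg_apply, map_smul, InnerProductSpace.toDual_apply_apply, smul_eq_mul,
      nsmul_eq_mul, Nat.cast_ofNat]
    have := Real.pi_pos
    field_simp

theorem integrableOn_newtonField_ball (R : ℝ) :
    IntegrableOn newtonField (Metric.ball 0 R) := by
  have h : IntegrableOn (fun z : E3 => (fun r : ℝ => (4 * Real.pi)⁻¹ * (r ^ 2)⁻¹) ‖z‖)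
      (Metric.ball (0 : E3) R) := by
    rw [integrableOn_fun_norm_addHaar (volume : Measure E3) (f := fun r : ℝ => (4 * Real.pi)⁻¹ * (r ^ 2)⁻¹)]
    have : Module.finrank ℝ E3 - 1 = 2 := by simp
    rw [this]
    refine (integrableOn_const (C := (4 * Real.pi)⁻¹) (by simp)).congr_fun (fun r hr => ?_)
      measurableSet_Ioo
    have : r ≠ 0 := hr.1.ne'
    simp only [smul_eq_mul]
    field_simp
  refine Integrable.mono h measurable_newtonField.aestronglyMeasurable
    (Filter.Eventually.of_forall fun z => ?_)
  rw [norm_newtonField]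
  exact le_abs_self _

theorem locallyIntegrable_newtonField : LocallyIntegrable newtonField := by
  intro x
  refine ⟨Metric.ball 0 (‖x‖ + 1), Metric.isOpen_ball.mem_nhds (by simp), 
    integrableOn_newtonField_ball _⟩

/-! ### Newton's theorem for ellipsoids and the demagnetization operator -/

/-- A symmetric, positive definite linear map of `ℝ³`. -/
structure IsElliptic (A : E3 →L[ℝ] E3) : Prop where
  symm : ∀ x y, ⟪A x, y⟫ = ⟪x, A y⟫
  pos : ∃ c : ℝ, 0 < c ∧ ∀ x, c * ‖x‖ ^ 2 ≤ ⟪A x, x⟫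

namespace IsElliptic

variable {A : E3 →L[ℝ] E3}

theorem inner_self_pos (hA : IsElliptic A) {x : E3} (hx : x ≠ 0) : 0 < ⟪A x, x⟫ := by
  obtain ⟨c, hc, h⟩ := hA.pos
  have := norm_pos_iff.mpr hx
  exact lt_of_lt_of_le (by positivity) (h x)

theorem inner_sphere_pos (hA : IsElliptic A) (θ : Metric.sphere (0 : E3) 1) :
    0 < ⟪A θ, (θ : E3)⟫ :=
  hA.inner_self_pos (Metric.ne_of_mem_sphere θ.2 one_ne_zero)

theorem inner_self_nonneg (hA : IsElliptic A) (x : E3) : 0 ≤ ⟪A x, x⟫ := by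
  obtain ⟨c, hc, h⟩ := hA.pos
  exact le_trans (by positivity) (h x)

theorem inner_add_smul (hA : IsElliptic A) (y w : E3) (r : ℝ) :
    ⟪A (y + r • w), y + r • w⟫ = ⟪A w, w⟫ * r ^ 2 + 2 * ⟪A y, w⟫ * r + ⟪A y, y⟫ := by
  have : ⟪A w, y⟫ = ⟪A y, w⟫ := by rw [hA.symm, real_inner_comm]
  simp only [map_add, map_smul, inner_add_left, inner_add_right, inner_smul_left, inner_smul_right,
    RCLike.conj_to_real, this]
  ring

theorem exists_norm_le (hA : IsElliptic A) (C : ℝ) :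
    ∃ R : ℝ, 0 < R ∧ ∀ x, ⟪A x, x⟫ < C → ‖x‖ < R := by
  obtain ⟨c, hc, h⟩ := hA.pos
  refine ⟨Real.sqrt (|C| / c) + 1, by positivity, fun x hx => ?_⟩
  have h1 : ‖x‖ ^ 2 ≤ |C| / c := by
    rw [le_div_iff₀ hc]
    have := h x
    have := le_abs_self C
    linarith
  have := Real.le_sqrt_of_sq_le h1
  linarith

end IsElliptic

open Set in
/-- The difference of the integrals of a cut-off of a quadratic polynomial over the two half-lines
issuing from a point where the cut-off equals one. -/
theorem integral_Ioi_quadratic_sub {η : ℝ → ℝ} (hη : Measurable η) (hb : ∀ t, |η t| ≤ 1) {c C : ℝ}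
    (h1 : ∀ t, t < c → η t = 1) (h0 : ∀ t, C ≤ t → η t = 0) {a b q : ℝ} (ha : 0 < a) (hq : q < c) :
    (∫ r in Ioi (0 : ℝ), η (a * r ^ 2 + 2 * b * r + q)) -
      (∫ r in Ioi (0 : ℝ), η (a * r ^ 2 - 2 * b * r + q)) = -(2 * (b / a)) := by
  -- Completing the square: shifting r by β and by -β turns both integrands into the same function
  -- g, so the difference is minus the integral of g over (-β, β).
  set β := b / a with hβ
  have hbβ : b = a * β := by rw [hβ]; field_simp
  set m := q - a * β ^ 2 with hm
  set g : ℝ → ℝ := fun ρ => η (a * ρ ^ 2 + m) with hg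
  have e1 : (∫ r in Ioi (0 : ℝ), η (a * r ^ 2 + 2 * b * r + q)) = ∫ r in Ioi β, g r := by
    rw [← (measurePreserving_add_right volume β).setIntegral_preimage_emb
      (measurableEmbedding_addRight β) g, preimage_add_const_Ioi, sub_self]
    refine setIntegral_congr_fun measurableSet_Ioi fun r _ => ?_
    simp only [hg, hm, hbβ]
    congr 1; ring
  have e2 : (∫ r in Ioi (0 : ℝ), η (a * r ^ 2 - 2 * b * r + q)) = ∫ r in Ioi (-β), g r := by
    rw [← (measurePreserving_add_right volume (-β)).setIntegral_preimage_emb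
      (measurableEmbedding_addRight (-β)) g, preimage_add_const_Ioi, sub_self]
    refine setIntegral_congr_fun measurableSet_Ioi fun r _ => ?_
    simp only [hg, hm, hbβ]
    congr 1; ring
  have hgm : Measurable g := hη.comp (by fun_prop)
  have hgi : Integrable g := by
    -- Beyond |ρ| = T the argument a ρ² + m is at least C, so g has bounded support.
    set T := Real.sqrt (|C - m| / a) with hT
    have hon : IntegrableOn g (Icc (-T) T) := by
      refine Measure.integrableOn_of_bounded (M := 1) (by simp) hgm.aestronglyMeasurable
        (Filter.Eventually.of_forall fun x => hb _)
    refine (integrableOn_iff_integrable_of_support_subset fun x hx => ?_).mp hon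
    by_contra hxT
    refine hx (h0 _ ?_)
    have : T < |x| := by
      rw [mem_Icc, ← abs_le] at hxT
      exact not_le.mp hxT
    have h2 : |C - m| / a < |x| ^ 2 := Real.lt_sq_of_sqrt_lt this
    rw [div_lt_iff₀ ha, sq_abs] at h2
    have := le_abs_self (C - m)
    nlinarith
  rw [e1, e2, ← neg_sub, intervalIntegral.integral_Ioi_sub_Ioi' hgi.integrableOn hgi.integrableOn]
  congr 1
  -- Between -β and β the argument is at most a β² + m = q < c, where the cut-off is 1.
  have : ∫ x in (-β)..β, g x = ∫ x in (-β)..β, (1 : ℝ) := by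
    refine intervalIntegral.integral_congr fun x hx => ?_
    refine h1 _ ?_
    have hx' : |x| ≤ |β| := by
      rcases le_total 0 β with h | h
      · rw [uIcc_of_le (by linarith)] at hx
        rw [abs_of_nonneg h, abs_le]; exact hx
      · rw [uIcc_of_ge (by linarith)] at hx
        rw [abs_of_nonpos h, abs_le, neg_neg]; exact hx
    have hx2 : x ^ 2 ≤ β ^ 2 := sq_le_sq.mpr hx'
    have := mul_le_mul_of_nonneg_left hx2 ha.le
    simp only [hm]; linarith
  rw [this]
  simp
  ring

open Set Metric in
/-- The demagnetization operator `E ↦ (4π)⁻¹ ∫_{S²} (⟪Aθ, E⟫ / ⟪Aθ, θ⟫) θ dθ` of the ellipsoid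
`{x | ⟪A x, x⟫ < 1}`. -/
noncomputable def demag (A : E3 →L[ℝ] E3) (E : E3) : E3 :=
  ∫ θ : sphere (0 : E3) 1, ((4 * Real.pi)⁻¹ * (⟪A θ, E⟫ / ⟪A θ, (θ : E3)⟫)) • (θ : E3)
    ∂(volume : Measure E3).toSphere

namespace IsElliptic

variable {A : E3 →L[ℝ] E3} (hA : IsElliptic A)
include hA

open Metric in
theorem integrable_demag (E : E3) : Integrable (fun θ : sphere (0 : E3) 1 =>
    ((4 * Real.pi)⁻¹ * (⟪A θ, E⟫ / ⟪A θ, (θ : E3)⟫)) • (θ : E3))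
      (volume : Measure E3).toSphere := by
  refine Continuous.integrable_of_hasCompactSupport ?_ (HasCompactSupport.of_compactSpace _)
  have h1 : Continuous fun θ : sphere (0 : E3) 1 => ⟪A θ, E⟫ / ⟪A θ, (θ : E3)⟫ := by
    refine Continuous.div (by fun_prop) (by fun_prop) fun θ => (hA.inner_sphere_pos θ).ne'
  exact (continuous_const.mul h1).smul continuous_subtype_val

theorem demag_add_smul (y E : E3) (s : ℝ) :
    demag A (y + s • E) = demag A y + s • demag A E := by
  unfold demag
  rw [← integral_smul]
  refine Eq.trans ?_ (integral_add (hA.integrable_demag y) ((hA.integrable_demag E).smul s))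
  refine integral_congr_ae (Filter.Eventually.of_forall fun θ => ?_)
  simp only [inner_add_right, inner_smul_right, smul_smul, ← add_smul]
  congr 1
  ring

open Set Metric in
/-- **Newton's theorem for ellipsoids**: the field of an ellipsoidally layered density is linear in
the region where the density equals one. -/
theorem integral_newtonField_mul {η : ℝ → ℝ} (hη : Measurable η) (hb : ∀ t, |η t| ≤ 1) {c C : ℝ}
    (h1 : ∀ t, t < c → η t = 1) (h0 : ∀ t, C ≤ t → η t = 0) {y : E3} (hy : ⟪A y, y⟫ < c) :
    ∫ x, η ⟪A x, x⟫ • newtonField (x - y) = demag A y := by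
  obtain ⟨R, hR, hRx⟩ := hA.exists_norm_le C
  have hqm : Measurable fun z : E3 => η ⟪A (y + z), y + z⟫ :=
    hη.comp (Continuous.measurable (by fun_prop))
  set f : E3 → E3 := fun z => η ⟪A (y + z), y + z⟫ • newtonField z with hf
  have hfi : Integrable f := by
    have hon : IntegrableOn f (ball 0 (R + ‖y‖)) := by
      refine Integrable.mono (integrableOn_newtonField_ball (R + ‖y‖))
        (hqm.smul measurable_newtonField).aestronglyMeasurable
        (Filter.Eventually.of_forall fun z => ?_)
      rw [hf, norm_smul]
      exact mul_le_of_le_one_left (norm_nonneg _) (hb _)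
    refine (integrableOn_iff_integrable_of_support_subset fun z hz => ?_).mp hon
    by_contra hzR
    refine hz ?_
    rw [mem_ball_zero_iff, not_lt] at hzR
    have : ¬ ⟪A (y + z), y + z⟫ < C := fun hlt => by
      have h2 := hRx _ hlt
      have h3 := norm_sub_le (y + z) y
      simp only [add_sub_cancel_left] at h3
      linarith
    simp only [hf, h0 _ (not_lt.mp this), zero_smul]
  -- Translating by y puts the singularity of the kernel at the origin, ready for polar coordinates.
  have e1 : ∫ x, η ⟪A x, x⟫ • newtonField (x - y) = ∫ z, f z := by
    rw [← integral_add_right_eq_self _ y]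
    refine integral_congr_ae (Filter.Eventually.of_forall fun z => ?_)
    simp [hf, add_comm]
  obtain ⟨hint, heq⟩ := integral_polar f hfi
  set h : E3 → ℝ := fun w => ∫ r in Ioi (0 : ℝ), η (⟪A w, w⟫ * r ^ 2 + 2 * ⟪A y, w⟫ * r + ⟪A y, y⟫)
    with hh
  have e2 : ∀ θ : sphere (0 : E3) 1, (∫ r in Ioi (0 : ℝ), r ^ 2 • f (r • (θ : E3))) =
      (fun w : E3 => (-(4 * Real.pi)⁻¹ * h w) • w) θ := by
    intro θ
    simp only [hh]
    rw [← integral_const_mul, ← integral_smul_const]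
    refine setIntegral_congr_fun measurableSet_Ioi fun r hr => ?_
    simp only [hf]
    rw [smul_comm, sq_smul_newtonField_smul θ hr, hA.inner_add_smul, ← neg_smul, smul_smul,
      mul_comm]
  simp only [e2] at hint heq
  have hneg := integrable_sphere_neg (fun w : E3 => (-(4 * Real.pi)⁻¹ * h w) • w) hint
  have e3 := integral_sphere_neg fun w : E3 => (-(4 * Real.pi)⁻¹ * h w) • w
  -- One of the two copies is rewritten with -θ. The factor θ is odd, so the sum involves only h(θ)
  -- - h(-θ), which is linear in y.
  have e4 : (2 : ℝ) • ∫ z, f z = (2 : ℝ) • demag A y := by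
    rw [two_smul ℝ (∫ z, f z)]
    nth_rewrite 2 [heq]
    rw [heq, ← e3, e3, ← e3]
    nth_rewrite 1 [e3]
    rw [← integral_add hint hneg, demag, ← integral_smul]
    refine integral_congr_ae (Filter.Eventually.of_forall fun θ => ?_)
    have key := integral_Ioi_quadratic_sub hη hb h1 h0 (b := ⟪A y, (θ : E3)⟫)
      (hA.inner_sphere_pos θ) hy
    have hneg' : h (-(θ : E3)) = ∫ r in Ioi (0 : ℝ),
        η (⟪A θ, (θ : E3)⟫ * r ^ 2 - 2 * ⟪A y, (θ : E3)⟫ * r + ⟪A y, y⟫) := by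
      simp only [hh, map_neg, inner_neg_right, inner_neg_left, neg_neg]
      refine setIntegral_congr_fun measurableSet_Ioi fun r hr => ?_
      congr 1; ring
    rw [← hneg'] at key
    have key' : h θ - h (-(θ : E3)) = -(2 * (⟪A y, (θ : E3)⟫ / ⟪A θ, (θ : E3)⟫)) := key
    simp only [smul_neg, ← neg_smul, ← add_smul, smul_smul]
    congr 1
    rw [hA.symm θ y, real_inner_comm]
    linear_combination (-(4 * Real.pi)⁻¹) * key'
  rw [e1]
  exact smul_right_injective E3 (two_ne_zero (α := ℝ)) e4

/-- The demagnetization operator is diagonal in every orthonormal eigenbasis. -/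
theorem inner_demag_basis (b : OrthonormalBasis (Fin 3) ℝ E3)
    (α : Fin 3 → ℝ) (hb : ∀ i, A (b i) = α i • b i) {i j : Fin 3} (hij : i ≠ j) :
    ⟪b i, demag A (b j)⟫ = 0 := by
  -- Reflecting in the plane orthogonal to `b i` preserves the quadratic form and the j-th
  -- coordinate but flips the i-th one, so the integrand is odd.
  set e := (Submodule.span ℝ {b i})ᗮ.reflection with he
  have hbi : ‖b i‖ = 1 := b.norm_eq_one i
  have hew : ∀ w, e w = w - (2 * ⟪b i, w⟫) • b i := by
    intro w
    rw [he, Submodule.reflection_orthogonal_apply, Submodule.reflection_singleton_apply]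
    simp [hbi, two_smul, two_mul, add_smul]
  have hij' : ⟪b i, b j⟫ = 0 := b.orthonormal.2 hij
  have hii : ⟪b i, b i⟫ = 1 := by rw [real_inner_self_eq_norm_sq, hbi, one_pow]
  have hAi : ∀ w, ⟪A w, b i⟫ = α i * ⟪b i, w⟫ := by
    intro w
    rw [hA.symm, hb, inner_smul_right, real_inner_comm]
  have hAj : ∀ w, ⟪A w, b j⟫ = α j * ⟪b j, w⟫ := by
    intro w
    rw [hA.symm, hb, inner_smul_right, real_inner_comm]
  have key := integral_sphere_comp_linearIsometryEquiv e
    (fun w : E3 => ⟪b i, ((4 * Real.pi)⁻¹ * (⟪A w, b j⟫ / ⟪A w, w⟫)) • w⟫)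
  have hodd : ∀ w, ⟪b i, ((4 * Real.pi)⁻¹ * (⟪A (e w), b j⟫ / ⟪A (e w), e w⟫)) • e w⟫ =
      -⟪b i, ((4 * Real.pi)⁻¹ * (⟪A w, b j⟫ / ⟪A w, w⟫)) • w⟫ := by
    intro w
    have h1 : ⟪A (e w), e w⟫ = ⟪A w, w⟫ := by
      rw [hew, sub_eq_add_neg, ← neg_smul, hA.inner_add_smul, hAi, hAi, hii]
      ring
    have h2 : ⟪b j, e w⟫ = ⟪b j, w⟫ := by
      rw [hew, inner_sub_right, inner_smul_right, real_inner_comm (b i) (b j), hij']; simp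
    have h3 : ⟪b i, e w⟫ = -⟪b i, w⟫ := by
      rw [hew, inner_sub_right, inner_smul_right, hii]; ring
    rw [h1, hAj, h2, inner_smul_right, h3, inner_smul_right, hAj]
    ring
  simp only [hodd, integral_neg] at key
  rw [demag, ← integral_inner (hA.integrable_demag (b j))]
  linarith

/-- The demagnetization operator is symmetric. -/
theorem inner_demag_comm (b : OrthonormalBasis (Fin 3) ℝ E3)
    (α : Fin 3 → ℝ) (hb : ∀ i, A (b i) = α i • b i) (x y : E3) :
    ⟪x, demag A y⟫ = ⟪demag A x, y⟫ := by
  have hlin : ∀ x : E3, demag A x = ∑ i, ⟪b i, x⟫ • demag A (b i) := by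
    intro x
    have h0 : demag A 0 = 0 := by simp [demag]
    conv_lhs => rw [← b.sum_repr x]
    simp only [Fin.sum_univ_three, b.repr_apply_apply]
    rw [hA.demag_add_smul, hA.demag_add_smul, ← zero_add (⟪b 0, x⟫ • b 0), hA.demag_add_smul, h0,
      zero_add]
  have hdiag : ∀ i, demag A (b i) = ⟪b i, demag A (b i)⟫ • b i := by
    intro i
    conv_lhs => rw [← b.sum_repr (demag A (b i))]
    simp only [b.repr_apply_apply]
    refine Finset.sum_eq_single i (fun j _ hj => ?_) (by simp)
    rw [hA.inner_demag_basis b α hb hj, zero_smul]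
  rw [hlin x, hlin y, inner_sum, sum_inner]
  refine Finset.sum_congr rfl fun i _ => ?_
  rw [hdiag i]
  simp only [inner_smul_left, inner_smul_right, RCLike.conj_to_real, real_inner_comm x (b i)]
  ring

end IsElliptic

/-! ### Potentials of constant fields in the ellipsoid -/

/-- The solid ellipsoid `{x | ⟪A x, x⟫ < 1}`. -/
def solidEllipsoid (A : E3 →L[ℝ] E3) : Set E3 := {x | ⟪A x, x⟫ < 1}

theorem isOpen_solidEllipsoid (A : E3 →L[ℝ] E3) : IsOpen (solidEllipsoid A) :=
  isOpen_lt (by fun_prop) continuous_const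

theorem inner_gradient_eq_fderiv {ψ : E3 → ℝ} {x : E3} (h : DifferentiableAt ℝ ψ x) (v : E3) :
    ⟪gradient ψ x, v⟫ = fderiv ℝ ψ x v := by
  rw [h.hasGradientAt.hasFDerivAt.fderiv, InnerProductSpace.toDual_apply_apply]

theorem continuous_gradient {ψ : E3 → ℝ} (h : ContDiff ℝ ∞ ψ) : Continuous (gradient ψ) :=
  (InnerProductSpace.toDual ℝ E3).symm.continuous.comp (h.continuous_fderiv (by simp))

theorem gradient_eq_zero_of_notMem_tsupport {ψ : E3 → ℝ} {x : E3} (h : x ∉ tsupport ψ) :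
    gradient ψ x = 0 := by
  have : fderiv ℝ ψ x = 0 := by
    by_contra h0
    exact h (support_fderiv_subset ℝ h0)
  simp [gradient, this]

/-- A linear function has its constant gradient as weak gradient. -/
theorem HasWeakGradientOn.inner_const {D : Set E3} (hD : IsOpen D) {u : E3 → ℝ} {F : E3}
    (hu : ∀ x ∈ D, u x = ⟪F, x⟫) : HasWeakGradientOn D u (fun _ => F) := by
  refine ⟨?_, (locallyIntegrable_const F).locallyIntegrableOn D, fun ψ h1 h2 h3 => ?_⟩
  · refine ContinuousOn.locallyIntegrableOn ?_ hD.measurableSet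
    exact (Continuous.continuousOn (f := fun x : E3 => ⟪F, x⟫) (by fun_prop)).congr hu
  -- The function u is linear only on D, but ψ is supported there, so both integrals extend to the
  -- whole space with the globally linear function, where integration by parts applies.
  · have e1 : ∫ x in D, u x • gradient ψ x = ∫ x, ⟪F, x⟫ • gradient ψ x := by
      refine (setIntegral_congr_fun hD.measurableSet
        (g := fun x => ⟪F, x⟫ • gradient ψ x) fun x hx => by rw [hu x hx]).trans
        (setIntegral_eq_integral_of_forall_compl_eq_zero fun x hx => ?_)
      rw [gradient_eq_zero_of_notMem_tsupport fun hx' => hx (h3 hx'), smul_zero]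
    have e2 : ∫ x in D, ψ x • F = ∫ x, ψ x • F :=
      setIntegral_eq_integral_of_forall_compl_eq_zero fun x hx => by
        rw [image_eq_zero_of_notMem_tsupport fun hx' => hx (h3 hx'), zero_smul]
    rw [e1, e2]
    have hg := continuous_gradient h1
    have hgs : HasCompactSupport (gradient ψ) := by
      refine h2.mono' fun x hx => ?_
      by_contra h
      exact hx (gradient_eq_zero_of_notMem_tsupport h)
    have i1 : Integrable fun x : E3 => ⟪F, x⟫ • gradient ψ x :=
      Continuous.integrable_of_hasCompactSupport (by fun_prop)
        (hgs.smul_left (f := fun x : E3 => ⟪F, x⟫))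
    have hψ := h1.continuous
    have i2 : Integrable fun x : E3 => ψ x • F :=
      Continuous.integrable_of_hasCompactSupport (hψ.smul continuous_const)
        (h2.smul_right (f' := fun _ => F))
    refine ext_inner_right ℝ fun v => ?_
    rw [inner_neg_left, real_inner_comm, ← integral_inner i1, real_inner_comm, ← integral_inner i2]
    have hdψ : Differentiable ℝ ψ := h1.differentiable (by simp)
    have hl : ∀ x : E3, fderiv ℝ (fun x : E3 => ⟪F, x⟫) x v = ⟪F, v⟫ := by
      intro x
      have : (fun x : E3 => ⟪F, x⟫) = innerSL ℝ F := by ext; simp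
      rw [this, ContinuousLinearMap.fderiv]; simp
    have hψ' : Continuous (fun x => fderiv ℝ ψ x v) :=
      (h1.continuous_fderiv (by simp)).clm_apply continuous_const
    have hs' : HasCompactSupport (fun x => fderiv ℝ ψ x v) := h2.fderiv_apply ℝ v
    have := integral_mul_fderiv_eq_neg_fderiv_mul_of_integrable (μ := (volume : Measure E3))
      (f := fun x : E3 => ⟪F, x⟫) (g := ψ) (v := v)
      (by
        simp only [hl]
        exact Continuous.integrable_of_hasCompactSupport (by fun_prop) h2.mul_left)
      (Continuous.integrable_of_hasCompactSupport (by fun_prop) hs'.mul_left)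
      (Continuous.integrable_of_hasCompactSupport (by fun_prop) h2.mul_left)
      (fun x _ => (innerSL ℝ F).differentiableAt) (fun x _ => hdψ x)
    simp only [hl] at this
    calc _ = ∫ x, ⟪F, x⟫ * fderiv ℝ ψ x v := by
          refine integral_congr_ae (Filter.Eventually.of_forall fun x => ?_)
          simp only [inner_smul_right]
          rw [real_inner_comm _ v, inner_gradient_eq_fderiv (hdψ x)]
      _ = _ := this
      _ = _ := by
          congr 1
          refine integral_congr_ae (Filter.Eventually.of_forall fun x => ?_)
          simp only [inner_smul_right]
          rw [real_inner_comm _ v, mul_comm]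

namespace IsElliptic

variable {A : E3 →L[ℝ] E3} (hA : IsElliptic A)
include hA

theorem exists_subset_ball : ∃ R : ℝ, 0 < R ∧ solidEllipsoid A ⊆ Metric.ball 0 R := by
  obtain ⟨R, hR, h⟩ := hA.exists_norm_le 1
  exact ⟨R, hR, fun x hx => by simpa using h x hx⟩

theorem volume_solidEllipsoid_lt_top : volume (solidEllipsoid A) < ⊤ := by
  obtain ⟨R, hR, h⟩ := hA.exists_subset_ball
  exact lt_of_le_of_lt (measure_mono h) measure_ball_lt_top

theorem integral_solidEllipsoid_newtonField {x : E3} (hx : x ∈ solidEllipsoid A) :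
    ∫ y in solidEllipsoid A, newtonField (x - y) = -demag A x := by
  have hB := (isOpen_solidEllipsoid A).measurableSet
  -- Newton's theorem for the sharp cut-off, the indicator of (-∞, 1), with both thresholds equal to
  -- 1.
  have h := hA.integral_newtonField_mul (η := (Set.Iio (1 : ℝ)).indicator 1) (c := 1) (C := 1)
    (measurable_one.indicator measurableSet_Iio)
    (fun t => by by_cases ht : t < 1 <;> simp [ht])
    (fun t ht => by simp [ht]) (fun t ht => by simp [ht]) (y := x) hx
  rw [← h, ← integral_indicator hB, ← integral_neg]
  refine integral_congr_ae (Filter.Eventually.of_forall fun y => ?_)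
  have hy : y ∈ solidEllipsoid A ↔ ⟪A y, y⟫ < 1 := Iff.rfl
  by_cases h : ⟪A y, y⟫ < 1
  · simp [hy, h, ← newtonField_neg]
  · simp [hy, h]

theorem staticPotential_const (E : E3) {x : E3} (hx : x ∈ solidEllipsoid A) :
    staticPotential (solidEllipsoid A) (fun _ => E) x = -⟪demag A x, E⟫ := by
  obtain ⟨R, hR, hRB⟩ := hA.exists_subset_ball
  have hi : IntegrableOn (fun y => newtonField (x - y)) (solidEllipsoid A) := by
    have h1 := (integrableOn_newtonField_ball (‖x‖ + R))
    have h2 := ((Measure.measurePreserving_sub_left (volume : Measure E3) x).integrableOn_comp_preimage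
      (MeasurableEquiv.subLeft x).measurableEmbedding).mpr h1
    refine h2.mono_set fun y hy => ?_
    have := hRB hy
    simp only [Metric.mem_ball, dist_zero_right, Set.mem_preimage] at this ⊢
    exact lt_of_le_of_lt (norm_sub_le _ _) (by linarith)
  simp only [staticPotential, gradGreen_eq]
  simp only [real_inner_comm E]
  rw [integral_inner hi, hA.integral_solidEllipsoid_newtonField hx, inner_neg_right,
    real_inner_comm]

/-- Constant eigenvectors of the demagnetization operator are eigenvectors of the static
magnetization operator of the ellipsoid. -/
theorem isStaticMagnetization_const (hsymm : ∀ x y, ⟪x, demag A y⟫ = ⟪demag A x, y⟫) {E : E3}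
    {lam : ℝ} (hE : demag A E = lam • E) :
    IsStaticMagnetization (solidEllipsoid A) (fun _ => E) (fun _ => lam • E) := by
  have : IsFiniteMeasure (volume.restrict (solidEllipsoid A)) :=
    ⟨by simpa using hA.volume_solidEllipsoid_lt_top⟩
  refine ⟨memLp_const _, memLp_const _,
    HasWeakGradientOn.inner_const (isOpen_solidEllipsoid A) fun x hx => ?_⟩
  -- Symmetry moves `demag A` from the position x to the eigenvector E, which exhibits the gradient
  -- of the potential.
  rw [hA.staticPotential_const E hx, ← hsymm, hE, inner_neg_left, real_inner_comm]

end IsElliptic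

/-! ### Cut-offs and thin ellipsoidal shells -/

/-- Smooth cut-offs of the half-line `(-∞, 1)` with a transition layer of width `ε` on which the
derivative is of order `1 / ε`. -/
theorem exists_smooth_cutoff : ∃ M : ℝ, 0 < M ∧ ∀ ε : ℝ, 0 < ε → ∃ η : ℝ → ℝ,
    ContDiff ℝ ∞ η ∧ (∀ t, 0 ≤ η t) ∧ (∀ t, η t ≤ 1) ∧ (∀ t, t ≤ 1 - ε → η t = 1) ∧
      (∀ t, 1 - ε / 2 ≤ t → η t = 0) ∧ ∀ t, |deriv η t| ≤ M / ε := by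
  have hs : ContDiff ℝ ∞ Real.smoothTransition := Real.smoothTransition.contDiff
  have hd : Continuous (deriv Real.smoothTransition) := hs.continuous_deriv (by simp)
  obtain ⟨M, hM⟩ := (isCompact_Icc (a := (0 : ℝ)) (b := 1)).exists_bound_of_continuousOn
    hd.continuousOn
  have hM0 : 0 ≤ M := (norm_nonneg _).trans (hM 0 (by simp))
  have hbound : ∀ t, |deriv Real.smoothTransition t| ≤ M := by
    intro t
    by_cases ht : t ∈ Set.Icc (0 : ℝ) 1
    · exact hM t ht
    · have h0 : deriv Real.smoothTransition t = 0 := by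
        rw [Set.mem_Icc, not_and_or, not_le, not_le] at ht
        rcases ht with ht | ht
        · have : Real.smoothTransition =ᶠ[𝓝 t] fun _ => 0 := by
            filter_upwards [Iio_mem_nhds ht] with s hs
            exact Real.smoothTransition.zero_of_nonpos (le_of_lt hs)
          rw [this.deriv_eq]; simp
        · have : Real.smoothTransition =ᶠ[𝓝 t] fun _ => 1 := by
            filter_upwards [Ioi_mem_nhds ht] with s hs
            exact Real.smoothTransition.one_of_one_le (le_of_lt hs)
          rw [this.deriv_eq]; simp
      rw [h0]; simpa using hM0
  -- The factor 2 is from the slope 2 / ε of the rescaling; adding 1 to M only makes the constant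
  -- positive.
  refine ⟨2 * (M + 1), by positivity, fun ε hε => ?_⟩
  -- The affine map sends 1 - ε to 1 and 1 - ε / 2 to 0. The layer stops short of t = 1, so that the
  -- cut-off has compact support in the open ellipsoid.
  refine ⟨fun t => Real.smoothTransition ((1 - ε / 2 - t) * (2 / ε)), ?_, fun t =>
    Real.smoothTransition.nonneg _, fun t => Real.smoothTransition.le_one _, fun t ht => ?_,
    fun t ht => ?_, fun t => ?_⟩
  · exact hs.comp (by fun_prop)
  · refine Real.smoothTransition.one_of_one_le ?_
    rw [← div_le_iff₀ (by positivity)]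
    rw [one_div_div]; linarith
  · refine Real.smoothTransition.zero_of_nonpos ?_
    exact mul_nonpos_of_nonpos_of_nonneg (by linarith) (by positivity)
  · have h1 : HasDerivAt (fun t : ℝ => (1 - ε / 2 - t) * (2 / ε)) (-1 * (2 / ε)) t :=
      ((hasDerivAt_id t).const_sub _).mul_const _
    have h2 := ((hs.differentiable (by simp)) ((1 - ε / 2 - t) * (2 / ε))).hasDerivAt.comp t h1
    have h3 : deriv (fun t => Real.smoothTransition ((1 - ε / 2 - t) * (2 / ε))) t =
      deriv Real.smoothTransition ((1 - ε / 2 - t) * (2 / ε)) * (-1 * (2 / ε)) := h2.deriv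
    rw [h3, abs_mul, abs_mul, abs_neg, abs_one, one_mul, abs_of_pos (by positivity : 0 < 2 / ε)]
    have := hbound ((1 - ε / 2 - t) * (2 / ε))
    calc _ ≤ (M + 1) * (2 / ε) := by gcongr; linarith
      _ = _ := by ring

open Set in
/-- A sublevel shell of a quadratic polynomial is short. -/
theorem volume_quadratic_shell_le {a b q c s ε : ℝ} (hc : 0 < c) (hca : c ≤ a) :
    volume {r : ℝ | s ≤ a * r ^ 2 + 2 * b * r + q ∧ a * r ^ 2 + 2 * b * r + q < s + ε} ≤
      ENNReal.ofReal (2 * Real.sqrt (ε / c)) := by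
  set T := {r : ℝ | s ≤ a * r ^ 2 + 2 * b * r + q ∧ a * r ^ 2 + 2 * b * r + q < s + ε} with hT
  have ha : 0 < a := hc.trans_le hca
  -- The last factor is 2(a r₁ + b). When r₂ - r₁ has the same sign as it, moving from r₁ to r₂
  -- leads away from the vertex and the polynomial grows by at least a(r₂ - r₁)², which must be
  -- below ε.
  have key : ∀ r₁ ∈ T, ∀ r₂ ∈ T, 0 ≤ (r₂ - r₁) * (a * (r₁ + r₂) + 2 * b - a * (r₂ - r₁)) →
      |r₂ - r₁| ≤ Real.sqrt (ε / c) := by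
    intro r₁ h1 r₂ h2 h
    refine Real.abs_le_sqrt ?_
    rw [le_div_iff₀ hc]
    have := h1.1; have := h2.2
    have : (r₂ - r₁) ^ 2 * c ≤ (r₂ - r₁) ^ 2 * a := by gcongr
    nlinarith
  have hpart : ∀ T' ⊆ T, (∀ r₁ ∈ T', ∀ r₂ ∈ T', r₁ ≤ r₂ → |r₂ - r₁| ≤ Real.sqrt (ε / c)) →
      volume T' ≤ ENNReal.ofReal (Real.sqrt (ε / c)) := by
    intro T' _ h
    refine (Real.volume_le_diam _).trans (Metric.ediam_le fun r₁ h1 r₂ h2 => ?_)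
    rw [edist_dist, Real.dist_eq]
    refine ENNReal.ofReal_le_ofReal ?_
    rcases le_total r₁ r₂ with h12 | h12
    · rw [abs_sub_comm]; exact h _ h1 _ h2 h12
    · exact h _ h2 _ h1 h12
  -- Splitting at the vertex leaves two pieces, each of diameter at most √(ε / c).
  have hsub : T ⊆ (T ∩ {r | 0 ≤ a * r + b}) ∪ (T ∩ {r | a * r + b ≤ 0}) := by
    intro r hr
    rcases le_total 0 (a * r + b) with h | h
    · exact Or.inl ⟨hr, h⟩
    · exact Or.inr ⟨hr, h⟩
  have hs0 := Real.sqrt_nonneg (ε / c)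
  rw [two_mul, ENNReal.ofReal_add hs0 hs0]
  refine (measure_mono hsub).trans ((measure_union_le _ _).trans (add_le_add ?_ ?_))
  · refine hpart _ inter_subset_left fun r₁ h1 r₂ h2 h12 => key _ h1.1 _ h2.1 ?_
    have := h1.2; simp only [mem_ofPred_eq] at this
    exact mul_nonneg (by linarith) (by nlinarith)
  · refine hpart _ inter_subset_left fun r₁ h1 r₂ h2 h12 => ?_
    rw [abs_sub_comm]
    refine key _ h2.1 _ h1.1 ?_
    have := h2.2; simp only [mem_ofPred_eq] at this
    exact mul_nonneg_of_nonpos_of_nonpos (by linarith) (by nlinarith)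

/-- The shell `{x | 1 - ε ≤ ⟪A x, x⟫ < 1}`. -/
def ellipsoidShell (A : E3 →L[ℝ] E3) (ε : ℝ) : Set E3 := {x | 1 - ε ≤ ⟪A x, x⟫ ∧ ⟪A x, x⟫ < 1}

theorem measurableSet_ellipsoidShell (A : E3 →L[ℝ] E3) (ε : ℝ) :
    MeasurableSet (ellipsoidShell A ε) :=
  (isClosed_le (f := fun _ => 1 - ε) (g := fun x : E3 => ⟪A x, x⟫) continuous_const
    (by fun_prop)).measurableSet.inter (isOpen_solidEllipsoid A).measurableSet

theorem ellipsoidShell_subset (A : E3 →L[ℝ] E3) (ε : ℝ) :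
    ellipsoidShell A ε ⊆ solidEllipsoid A := fun _ h => h.2

namespace IsElliptic

variable {A : E3 →L[ℝ] E3} (hA : IsElliptic A)
include hA

-- In polar coordinates about y the kernel leaves the constant 1 / (4π), and each ray meets the
-- shell in length at most 2√(ε / c). The bound is uniform in y because c bounds ⟪A θ, θ⟫ from below
-- for all directions.
open Set Metric in
theorem exists_lintegral_newtonField_shell_le : ∃ C : ℝ, 0 ≤ C ∧ ∀ ε : ℝ, 0 ≤ ε → ∀ y : E3,
    ∫⁻ x in ellipsoidShell A ε, ‖newtonField (x - y)‖ₑ ≤ ENNReal.ofReal (C * Real.sqrt ε) := by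
  obtain ⟨c, hc, hcA⟩ := hA.pos
  set σ := (volume : Measure E3).toSphere.real univ with hσ
  refine ⟨(4 * Real.pi)⁻¹ * (2 / Real.sqrt c) * σ, by positivity, fun ε hε y => ?_⟩
  have hm := measurableSet_ellipsoidShell A ε
  set f : E3 → ENNReal := fun z => ((fun z => y + z) ⁻¹' ellipsoidShell A ε).indicator
    (fun z => ‖newtonField z‖ₑ) z with hf
  have hfm : Measurable f :=
    measurable_newtonField.enorm.indicator (hm.preimage (by fun_prop))
  have e1 : ∫⁻ x in ellipsoidShell A ε, ‖newtonField (x - y)‖ₑ = ∫⁻ z, f z := by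
    rw [← lintegral_indicator hm, ← lintegral_add_left_eq_self _ y]
    refine lintegral_congr fun z => ?_
    by_cases h : y + z ∈ ellipsoidShell A ε <;> simp [hf, h]
  rw [e1, lintegral_polar f hfm]
  calc _ ≤ ∫⁻ θ : sphere (0 : E3) 1, ENNReal.ofReal ((4 * Real.pi)⁻¹ * (2 * Real.sqrt (ε / c)))
        ∂(volume : Measure E3).toSphere := by
        refine lintegral_mono fun θ => ?_
        have hθ : c ≤ ⟪A θ, (θ : E3)⟫ := by simpa using hcA θ
        have hmT : MeasurableSet {r : ℝ | y + r • (θ : E3) ∈ ellipsoidShell A ε} :=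
          hm.preimage (f := fun r : ℝ => y + r • (θ : E3)) (by fun_prop)
        calc _ ≤ ∫⁻ r in Ioi (0 : ℝ), {r : ℝ | y + r • (θ : E3) ∈ ellipsoidShell A ε}.indicator
              (fun _ => ENNReal.ofReal (4 * Real.pi)⁻¹) r := by
              refine setLIntegral_mono' measurableSet_Ioi fun r hr => ?_
              by_cases h : y + r • (θ : E3) ∈ ellipsoidShell A ε
              · have hr0 : (0 : ℝ) < r := hr
                have hθ1 : ‖(θ : E3)‖ = 1 := by simp
                simp only [hf, indicator, mem_preimage, h, if_true, mem_ofPred_eq]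
                rw [← ofReal_norm, ← ENNReal.ofReal_mul (sq_nonneg r), norm_newtonField,
                  norm_smul, hθ1, Real.norm_of_nonneg hr0.le]
                refine ENNReal.ofReal_le_ofReal (le_of_eq ?_)
                field_simp
              · simp [hf, indicator, h]
          _ ≤ ∫⁻ r, {r : ℝ | y + r • (θ : E3) ∈ ellipsoidShell A ε}.indicator
              (fun _ => ENNReal.ofReal (4 * Real.pi)⁻¹) r := setLIntegral_le_lintegral _ _
          _ = ENNReal.ofReal (4 * Real.pi)⁻¹ *
              volume {r : ℝ | y + r • (θ : E3) ∈ ellipsoidShell A ε} := by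
              rw [lintegral_indicator_const hmT]
          _ ≤ _ := by
              rw [ENNReal.ofReal_mul (by positivity)]
              gcongr
              have := volume_quadratic_shell_le (b := ⟪A y, (θ : E3)⟫) (q := ⟪A y, y⟫)
                (s := 1 - ε) (ε := ε) hc hθ
              refine le_trans (measure_mono fun r hr => ?_) this
              simp only [mem_ofPred_eq, ellipsoidShell, hA.inner_add_smul] at hr ⊢
              exact ⟨hr.1, by linarith [hr.2]⟩
    _ = _ := by
        rw [lintegral_const, ← ofReal_measureReal, ← ENNReal.ofReal_mul (by positivity)]
        congr 1
        rw [Real.sqrt_div hε]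
        ring

-- The shell is disjoint from the ellipsoid scaled by 1 - ε, of relative volume (1 - ε)³ ≥ 1 - 3ε.
-- The factor 1 - ε, instead of its square root, is cruder but sufficient.
open Set Metric Pointwise in
theorem volume_ellipsoidShell_le {ε : ℝ} (h0 : 0 < ε) (h1 : ε < 1) :
    volume.real (ellipsoidShell A ε) ≤ 3 * ε * volume.real (solidEllipsoid A) := by
  have hfin := hA.volume_solidEllipsoid_lt_top.ne
  have hB := (isOpen_solidEllipsoid A).measurableSet
  have hmem : ∀ x, x ∈ (1 - ε) • solidEllipsoid A → ⟪A x, x⟫ < 1 - ε := by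
    rintro _ ⟨x, hx, rfl⟩
    have hx1 : ⟪A x, x⟫ < 1 := hx
    simp only [map_smul, inner_smul_left, inner_smul_right, RCLike.conj_to_real]
    have h2 : 0 < (1 - ε) * (1 - ε) := mul_pos (sub_pos.mpr h1) (sub_pos.mpr h1)
    nlinarith [mul_lt_mul_of_pos_left hx1 h2]
  have hd : Disjoint (ellipsoidShell A ε) ((1 - ε) • solidEllipsoid A) := by
    rw [Set.disjoint_left]
    exact fun x hx hx' => absurd (hmem x hx') (not_lt.mpr hx.1)
  have hm : MeasurableSet ((1 - ε) • solidEllipsoid A) :=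
    hB.const_smul₀ (1 - ε)
  have hsub : (1 - ε) • solidEllipsoid A ⊆ solidEllipsoid A := fun x hx =>
    (hmem x hx).trans (by linarith)
  have h2 : volume.real (ellipsoidShell A ε) + volume.real ((1 - ε) • solidEllipsoid A) ≤
      volume.real (solidEllipsoid A) := by
    rw [← measureReal_union hd hm (measure_ne_top_of_subset (ellipsoidShell_subset A ε) hfin)
      (measure_ne_top_of_subset hsub hfin)]
    exact measureReal_mono (union_subset (ellipsoidShell_subset A ε) hsub) hfin
  have h3 : volume.real ((1 - ε) • solidEllipsoid A) =
      (1 - ε) ^ 3 * volume.real (solidEllipsoid A) := by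
    rw [measureReal_def, Measure.addHaar_smul, ENNReal.toReal_mul, measureReal_def,
      ENNReal.toReal_ofReal (abs_nonneg _)]
    congr 1
    rw [abs_of_nonneg (pow_nonneg (sub_nonneg.mpr h1.le) _)]
    simp
  rw [h3] at h2
  have hv := measureReal_nonneg (μ := (volume : Measure E3)) (s := solidEllipsoid A)
  have h4 : 1 - 3 * ε ≤ (1 - ε) ^ 3 := by nlinarith [mul_pos h0 h0, mul_pos (mul_pos h0 h0) (sub_pos.mpr h1)]
  nlinarith [mul_le_mul_of_nonneg_right h4 hv]

end IsElliptic

/-! ### Cut-offs as test functions for the potential -/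

namespace IsElliptic

variable {A : E3 →L[ℝ] E3} (hA : IsElliptic A)
include hA

theorem hasFDerivAt_inner_self (x : E3) :
    HasFDerivAt (fun x => ⟪A x, x⟫) ((2 : ℝ) • innerSL ℝ (A x)) x := by
  have h := (A.hasFDerivAt (x := x)).inner ℝ (hasFDerivAt_id x)
  refine h.congr_fderiv ?_
  ext v
  simp [fderivInnerCLM_apply, hA.symm v x, real_inner_comm (A x) v, two_mul]

theorem fderiv_comp_inner_self {η : ℝ → ℝ} (hη : ContDiff ℝ ∞ η) (x E : E3) :
    fderiv ℝ (fun x => η ⟪A x, x⟫) x E = deriv η ⟪A x, x⟫ * (2 * ⟪A x, E⟫) := by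
  have h1 := ((hη.differentiable (by simp)) ⟪A x, x⟫).hasDerivAt
  have h2 := HasDerivAt.comp_hasFDerivAt (f := fun x => ⟪A x, x⟫) x h1 (hA.hasFDerivAt_inner_self x)
  have h3 : fderiv ℝ (fun x => η ⟪A x, x⟫) x = _ := h2.fderiv
  rw [h3]
  simp

omit hA in
theorem contDiff_comp_inner_self (A : E3 →L[ℝ] E3) {η : ℝ → ℝ} (hη : ContDiff ℝ ∞ η) :
    ContDiff ℝ ∞ (fun x => η ⟪A x, x⟫) :=
  hη.comp (A.contDiff.inner ℝ contDiff_id)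

omit hA in
theorem tsupport_comp_inner_self_subset (A : E3 →L[ℝ] E3) {η : ℝ → ℝ} {C : ℝ}
    (h0 : ∀ t, C ≤ t → η t = 0) : tsupport (fun x => η ⟪A x, x⟫) ⊆ {x | ⟪A x, x⟫ ≤ C} := by
  refine closure_minimal (fun x hx => ?_) (isClosed_le (by fun_prop) continuous_const)
  by_contra h
  exact hx (h0 _ (le_of_lt (not_le.mp h)))

theorem hasCompactSupport_comp_inner_self {η : ℝ → ℝ} {C : ℝ}
    (h0 : ∀ t, C ≤ t → η t = 0) : HasCompactSupport (fun x => η ⟪A x, x⟫) := by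
  obtain ⟨R, hR, h⟩ := hA.exists_norm_le (C + 1)
  refine HasCompactSupport.of_support_subset_isCompact (isCompact_closedBall (0 : E3) R)
    fun x hx => ?_
  by_contra hxR
  refine hx (h0 _ ?_)
  by_contra hlt
  have := h x (by linarith)
  exact hxR (by simpa using this.le)

/-- The potential operator applied to the derivative of an ellipsoidal cut-off. -/
theorem integral_fderiv_smul_newtonField {η : ℝ → ℝ} (hη : ContDiff ℝ ∞ η) (hb : ∀ t, |η t| ≤ 1)
    {c C : ℝ} (h1 : ∀ t, t < c → η t = 1) (h0 : ∀ t, C ≤ t → η t = 0) {y : E3}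
    (hy : ⟪A y, y⟫ < c) (E : E3) :
    ∫ x, fderiv ℝ (fun x => η ⟪A x, x⟫) x E • newtonField (x - y) = demag A E := by
  set ψ : E3 → ℝ := fun x => η ⟪A x, x⟫ with hψ
  have hψd : ContDiff ℝ ∞ ψ := contDiff_comp_inner_self A hη
  have hψs : HasCompactSupport ψ := hA.hasCompactSupport_comp_inner_self h0
  set f : E3 → E3 := fun t => newtonField (-t) with hf
  have hfl : LocallyIntegrable f := by
    have : f = -newtonField := by funext t; simp [hf, newtonField_neg]
    rw [this]; exact locallyIntegrable_newtonField.neg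
  set L : E3 →L[ℝ] ℝ →L[ℝ] E3 := (ContinuousLinearMap.lsmul ℝ ℝ).flip with hL
  -- The field of ψ is a convolution, known near y from Newton's theorem. Its derivative along E is
  -- computed twice: from this linear formula, and with the derivative falling on the smooth factor
  -- ψ.
  have hV : ∀ y : E3, ⟪A y, y⟫ < c → (convolution f ψ L volume) y = demag A y := by
    intro y hy
    rw [← hA.integral_newtonField_mul hη.continuous.measurable hb h1 h0 hy, convolution_def,
      ← integral_sub_left_eq_self _ volume y]
    refine integral_congr_ae (Filter.Eventually.of_forall fun t => ?_)
    simp [hL, hf, hψ]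
  have hd := hψs.hasFDerivAt_convolution_right L hfl (hψd.of_le (by simp)) y
  have hline : HasDerivAt (fun s : ℝ => y + s • E) E 0 := by
    simpa using ((hasDerivAt_id (0 : ℝ)).smul_const E).const_add y
  have hd' := HasFDerivAt.comp_hasDerivAt (0 : ℝ) (by simpa using hd) hline
  have hev : (convolution f ψ L volume ∘ fun s : ℝ => y + s • E) =ᶠ[𝓝 0]
      fun s => demag A y + s • demag A E := by
    have hc : Continuous fun s : ℝ => ⟪A (y + s • E), y + s • E⟫ := by fun_prop
    have := hc.tendsto 0
    simp only [zero_smul, add_zero] at this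
    filter_upwards [this.eventually (gt_mem_nhds hy)] with s hs
    rw [Function.comp_apply, hV _ hs, hA.demag_add_smul]
  have hd2 : HasDerivAt (fun s : ℝ => demag A y + s • demag A E) (demag A E) 0 := by
    simpa using ((hasDerivAt_id (0 : ℝ)).smul_const (demag A E)).const_add (demag A y)
  rw [(hd2.congr_of_eventuallyEq hev).unique hd', convolution_def]
  have hex := (hψs.fderiv ℝ).convolutionExists_right (L.precompR E3) hfl
    (hψd.continuous_fderiv (by simp)) y
  rw [ContinuousLinearMap.integral_apply hex, ← integral_sub_left_eq_self _ volume y]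
  refine integral_congr_ae (Filter.Eventually.of_forall fun t => ?_)
  simp [hL, hf]

theorem integrableOn_newtonField_sub (y : E3) :
    IntegrableOn (fun x => newtonField (x - y)) (solidEllipsoid A) := by
  obtain ⟨R, hR, hRB⟩ := hA.exists_subset_ball
  have h1 := (integrableOn_newtonField_ball (‖y‖ + R))
  have h2 := ((measurePreserving_sub_right (volume : Measure E3) y).integrableOn_comp_preimage
    (MeasurableEquiv.subRight y).measurableEmbedding).mpr h1
  refine h2.mono_set fun x hx => ?_
  have := hRB hx
  simp only [Metric.mem_ball, dist_zero_right, Set.mem_preimage] at this ⊢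
  exact lt_of_le_of_lt (norm_sub_le _ _) (by linarith)

theorem integrable_smul_newtonField_sub {g : E3 → ℝ} (hg : Continuous g) {M : ℝ}
    (hM : ∀ x, |g x| ≤ M) (hgB : ∀ x, x ∉ solidEllipsoid A → g x = 0) (y : E3) :
    Integrable fun x => g x • newtonField (x - y) := by
  have h1 : IntegrableOn (fun x => g x • newtonField (x - y)) (solidEllipsoid A) :=
    (hA.integrableOn_newtonField_sub y).bdd_smul M hg.aestronglyMeasurable
      (Filter.Eventually.of_forall hM)
  refine (integrableOn_iff_integrable_of_support_subset fun x hx => ?_).mp h1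
  by_contra h
  exact hx (by simp [hgB x h])

open Set in
/-- The static potential is adjoint to the convolution with the Newtonian field. -/
theorem integral_staticPotential_mul {φ : E3 → E3}
    (hφ : IntegrableOn φ (solidEllipsoid A)) {g : E3 → ℝ} (hg : Continuous g) {M : ℝ}
    (hM : ∀ x, |g x| ≤ M) (hgB : ∀ x, x ∉ solidEllipsoid A → g x = 0) :
    ∫ x in solidEllipsoid A, g x * staticPotential (solidEllipsoid A) φ x =
      ∫ y in solidEllipsoid A, ⟪∫ x, g x • newtonField (x - y), φ y⟫ := by
  obtain ⟨R, hR, hRB⟩ := hA.exists_subset_ball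
  have hB := (isOpen_solidEllipsoid A).measurableSet
  set B := solidEllipsoid A with hBdef
  -- Differences of two points of B have norm below 2R, so truncating the kernel there changes
  -- nothing and makes it integrable, as Fubini requires.
  set K := (Metric.ball (0 : E3) (2 * R)).indicator newtonField with hK
  have hKi : Integrable K :=
    (integrable_indicator_iff Metric.isOpen_ball.measurableSet).mpr (integrableOn_newtonField_ball _)
  have hφi : Integrable (B.indicator φ) := (integrable_indicator_iff hB).mpr hφ
  have hKeq : ∀ x ∈ B, ∀ y ∈ B, K (x - y) = newtonField (x - y) := by
    intro x hx y hy
    have h1 := hRB hx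
    have h2 := hRB hy
    simp only [Metric.mem_ball, dist_zero_right] at h1 h2
    refine indicator_of_mem ?_ _
    rw [Metric.mem_ball, dist_zero_right]
    exact lt_of_le_of_lt (norm_sub_le _ _) (by linarith)
  have hint := hφi.convolution_integrand (innerSL ℝ).flip hKi
  have hint2 : Integrable (fun p : E3 × E3 => g p.1 * ⟪K (p.1 - p.2), B.indicator φ p.2⟫)
      (volume.prod volume) := by
    refine Integrable.bdd_mul (c := M) ?_ (by fun_prop) (Filter.Eventually.of_forall fun p => hM _)
    exact hint
  have hswap := integral_integral_swap
    (f := fun x y => g x * ⟪K (x - y), B.indicator φ y⟫) hint2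
  have e1 : ∫ x in B, g x * staticPotential B φ x =
      ∫ x, ∫ y, g x * ⟪K (x - y), B.indicator φ y⟫ := by
    rw [← integral_indicator hB]
    refine integral_congr_ae (Filter.Eventually.of_forall fun x => ?_)
    simp only
    by_cases hx : x ∈ B
    · rw [indicator_of_mem hx, integral_const_mul, staticPotential, ← integral_indicator hB]
      congr 1
      refine integral_congr_ae (Filter.Eventually.of_forall fun y => ?_)
      by_cases hy : y ∈ B
      · simp [hy, gradGreen_eq, hKeq x hx y hy]
      · simp [hy]
    · simp [hx, hgB x hx]
  have e2 : ∫ y in B, ⟪∫ x, g x • newtonField (x - y), φ y⟫ =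
      ∫ y, ∫ x, g x * ⟪K (x - y), B.indicator φ y⟫ := by
    rw [← integral_indicator hB]
    refine integral_congr_ae (Filter.Eventually.of_forall fun y => ?_)
    simp only
    by_cases hy : y ∈ B
    · rw [indicator_of_mem hy, real_inner_comm,
        ← integral_inner (hA.integrable_smul_newtonField_sub hg hM hgB y)]
      refine integral_congr_ae (Filter.Eventually.of_forall fun x => ?_)
      by_cases hx : x ∈ B
      · simp [hy, hKeq x hx y hy, inner_smul_right, real_inner_comm]
      · simp [hgB x hx]
    · simp [hy]
  rw [e1, e2, hswap]

end IsElliptic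

/-! ### Means of eigenfunctions -/

open Set in
/-- An `L²` function has mean `o(√ε)` over sets of measure `O(ε)`. -/
theorem eq_zero_of_forall_le_setIntegral_div_sqrt {α : Type*} [MeasurableSpace α] {μ : Measure α}
    [IsFiniteMeasure μ] {f : α → E3} (hf : MemLp f 2 μ) {S : ℝ → Set α}
    {V N Δ : ℝ} (hV : ∀ ε, 0 < ε → ε < 1 → μ.real (S ε) ≤ ε * V) (hN : 0 ≤ N)
    (hΔ : ∀ ε, 0 < ε → ε < 1 → |Δ| ≤ N / Real.sqrt ε * ∫ x in S ε, ‖f x‖ ∂μ) : Δ = 0 := by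
  have hf2 : Integrable (fun x => ‖f x‖ ^ 2) μ := (memLp_two_iff_integrable_sq_norm hf.1).mp hf
  have hf1 : Integrable (fun x => ‖f x‖) μ := (hf.integrable (by norm_num)).norm
  have hS : Filter.Tendsto (μ ∘ S) (𝓝[>] 0) (𝓝 0) := by
    have h1 : Filter.Tendsto (fun ε : ℝ => ENNReal.ofReal (ε * V)) (𝓝[>] 0) (𝓝 0) := by
      have : Continuous fun ε : ℝ => ENNReal.ofReal (ε * V) :=
        ENNReal.continuous_ofReal.comp (by fun_prop)
      have := this.tendsto 0
      simp only [zero_mul, ENNReal.ofReal_zero] at this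
      exact this.mono_left nhdsWithin_le_nhds
    refine tendsto_of_tendsto_of_tendsto_of_le_of_le' tendsto_const_nhds h1
      (Filter.Eventually.of_forall fun _ => zero_le) ?_
    filter_upwards [Ioo_mem_nhdsGT (zero_lt_one (α := ℝ))] with ε hε
    rw [Function.comp_apply, ← ofReal_measureReal]
    exact ENNReal.ofReal_le_ofReal (hV ε hε.1 hε.2)
  have hlim := hf2.tendsto_setIntegral_nhds_zero hS
  -- For fixed δ, letting ε tend to 0 removes the integral of ‖f‖² over `S ε` by absolute
  -- continuity; δ is sent to 0 afterwards.
  have key : ∀ δ : ℝ, 0 < δ → |Δ| ≤ N * (δ / 2 * V) := by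
    intro δ hδ
    have h1 : Filter.Tendsto (fun ε => N * (δ / 2 * V + (∫ x in S ε, ‖f x‖ ^ 2 ∂μ) / (2 * δ)))
        (𝓝[>] 0) (𝓝 (N * (δ / 2 * V + 0 / (2 * δ)))) :=
      ((hlim.div_const _).const_add _).const_mul _
    simp only [zero_div, add_zero] at h1
    refine ge_of_tendsto h1 ?_
    filter_upwards [Ioo_mem_nhdsGT (zero_lt_one (α := ℝ))] with ε hε
    refine (hΔ ε hε.1 hε.2).trans ?_
    rw [div_mul_eq_mul_div, mul_div_assoc]
    refine mul_le_mul_of_nonneg_left ?_ hN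
    have hs : 0 < Real.sqrt ε := Real.sqrt_pos.mpr hε.1
    have hs2 : Real.sqrt ε ^ 2 = ε := Real.sq_sqrt hε.1.le
    -- Young's inequality with weight δ, from the square of δ / √ε - ‖f x‖. The first term
    -- integrates to at most δ V / 2.
    have hpt : ∀ x, ‖f x‖ / Real.sqrt ε ≤ δ / (2 * ε) + ‖f x‖ ^ 2 / (2 * δ) := by
      intro x
      have : 0 ≤ (δ / Real.sqrt ε - ‖f x‖) ^ 2 / (2 * δ) := by positivity
      have h2 : (δ / Real.sqrt ε - ‖f x‖) ^ 2 / (2 * δ) =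
          δ / (2 * Real.sqrt ε ^ 2) + ‖f x‖ ^ 2 / (2 * δ) - ‖f x‖ / Real.sqrt ε := by
        field_simp
        ring
      rw [hs2] at h2
      linarith
    calc (∫ x in S ε, ‖f x‖ ∂μ) / Real.sqrt ε = ∫ x in S ε, ‖f x‖ / Real.sqrt ε ∂μ :=
          (integral_div _ _).symm
      _ ≤ ∫ x in S ε, (δ / (2 * ε) + ‖f x‖ ^ 2 / (2 * δ)) ∂μ :=
          integral_mono (hf1.integrableOn.div_const _)
            ((integrable_const _).add (hf2.integrableOn.div_const _)) hpt
      _ = μ.real (S ε) * (δ / (2 * ε)) + (∫ x in S ε, ‖f x‖ ^ 2 ∂μ) / (2 * δ) := by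
          rw [integral_add (integrable_const _) (hf2.integrableOn.div_const _), integral_div]
          simp only [integral_const, measureReal_restrict_apply_univ, smul_eq_mul, integral_div, mul_div_assoc]
      _ ≤ _ := by
          refine add_le_add_left ?_ _
          calc _ ≤ (ε * V) * (δ / (2 * ε)) :=
                mul_le_mul_of_nonneg_right (hV ε hε.1 hε.2)
                  (div_nonneg hδ.le (mul_nonneg zero_le_two hε.1.le))
            _ = _ := by
                have := hε.1.ne'
                field_simp
  have hlim2 : Filter.Tendsto (fun δ : ℝ => N * (δ / 2 * V)) (𝓝[>] 0) (𝓝 0) := by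
    have : Continuous fun δ : ℝ => N * (δ / 2 * V) := by fun_prop
    have := this.tendsto 0
    simp only [zero_div, zero_mul, mul_zero] at this
    exact this.mono_left nhdsWithin_le_nhds
  have : |Δ| ≤ 0 := ge_of_tendsto hlim2 (by
    filter_upwards [self_mem_nhdsWithin] with δ hδ using key δ hδ)
  exact abs_nonpos_iff.mp this

namespace IsElliptic

variable {A : E3 →L[ℝ] E3} (hA : IsElliptic A)
include hA

/-- Testing the equation `𝒯φ = λφ` with a cut-off function. -/
theorem integral_inner_eq_of_isStaticMagnetization {φ : E3 → E3} {lam : ℝ}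
    (hφ : IsStaticMagnetization (solidEllipsoid A) φ (fun x => lam • φ x))
    (hφ1 : IntegrableOn φ (solidEllipsoid A)) {ψ : E3 → ℝ} (h1 : ContDiff ℝ ∞ ψ)
    (h2 : HasCompactSupport ψ) (h3 : tsupport ψ ⊆ solidEllipsoid A) (E : E3) :
    ∫ y in solidEllipsoid A, ⟪∫ x, fderiv ℝ ψ x E • newtonField (x - y), φ y⟫ =
      lam * ∫ x in solidEllipsoid A, ψ x * ⟪E, φ x⟫ := by
  have hg : Continuous fun x => fderiv ℝ ψ x E :=
    (h1.continuous_fderiv (by simp)).clm_apply continuous_const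
  have hgs : HasCompactSupport fun x => fderiv ℝ ψ x E := h2.fderiv_apply ℝ E
  obtain ⟨M, hM⟩ := hg.bounded_above_of_compact_support hgs
  have hgB : ∀ x, x ∉ solidEllipsoid A → fderiv ℝ ψ x E = 0 := fun x hx => by
    rw [← inner_gradient_eq_fderiv (h1.differentiable (by simp) x),
      gradient_eq_zero_of_notMem_tsupport fun h => hx (h3 h), inner_zero_left]
  rw [← hA.integral_staticPotential_mul hφ1 hg hM hgB]
  obtain ⟨hu, -, hw⟩ := hφ.2.2
  have hw := hw ψ h1 h2 h3
  have hint1 : IntegrableOn (fun x => staticPotential (solidEllipsoid A) φ x • gradient ψ x)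
      (solidEllipsoid A) := by
    have h4 : IntegrableOn (fun x => staticPotential (solidEllipsoid A) φ x • gradient ψ x)
        (tsupport ψ) :=
      (hu.integrableOn_compact_subset h3 h2).smul_continuousOn
        (continuous_gradient h1).continuousOn h2
    refine Integrable.integrableOn
      ((integrableOn_iff_integrable_of_support_subset fun x hx => ?_).mp h4)
    by_contra h
    exact hx (by simp [gradient_eq_zero_of_notMem_tsupport h])
  obtain ⟨M', hM'⟩ := h1.continuous.bounded_above_of_compact_support h2
  have hint2 : IntegrableOn (fun x => ψ x • φ x) (solidEllipsoid A) :=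
    hφ1.bdd_smul M' h1.continuous.aestronglyMeasurable (Filter.Eventually.of_forall hM')
  have e1 : -∫ x in solidEllipsoid A, ψ x • -(lam • φ x) =
      lam • ∫ x in solidEllipsoid A, ψ x • φ x := by
    rw [← integral_neg, ← integral_smul]
    refine integral_congr_ae (Filter.Eventually.of_forall fun x => ?_)
    simp only [smul_neg, neg_neg, smul_comm (ψ x)]
  rw [e1] at hw
  have hw' := congrArg (fun v => ⟪E, v⟫) hw
  simp only [inner_smul_right] at hw'
  rw [← integral_inner hint1, ← integral_inner hint2] at hw'
  simp only [inner_smul_right] at hw'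
  rw [← hw']
  refine integral_congr_ae (Filter.Eventually.of_forall fun x => ?_)
  simp only
  rw [real_inner_comm, inner_gradient_eq_fderiv (h1.differentiable (by simp) x), mul_comm]

/-- The field of the derivative of an ellipsoidal cut-off with a layer of width `ε` is of order
`1 / √ε`. -/
theorem exists_norm_integral_fderiv_le (E : E3) (M : ℝ) (hM : 0 < M) : ∃ N : ℝ, 0 ≤ N ∧
    ∀ (ε : ℝ) (η : ℝ → ℝ), 0 < ε → ContDiff ℝ ∞ η → (∀ t, t < 1 - ε → η t = 1) →
      (∀ t, 1 - ε / 2 ≤ t → η t = 0) → (∀ t, |deriv η t| ≤ M / ε) → ∀ y,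
      ‖∫ x, fderiv ℝ (fun x => η ⟪A x, x⟫) x E • newtonField (x - y)‖ ≤ N / Real.sqrt ε := by
  obtain ⟨C, hC, hshell⟩ := hA.exists_lintegral_newtonField_shell_le
  obtain ⟨R, hR, hRB⟩ := hA.exists_subset_ball
  -- On the shell the derivative of the cut-off is at most (M / ε) · 2‖A‖R‖E‖, and the kernel has
  -- integral at most C√ε over the shell.
  refine ⟨M * (2 * (‖A‖ * R * ‖E‖)) * C, by positivity, fun ε η hε hη h1 h0 hd y => ?_⟩
  have hpt : ∀ x, ‖fderiv ℝ (fun x => η ⟪A x, x⟫) x E • newtonField (x - y)‖ₑ ≤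
      (ellipsoidShell A ε).indicator (fun x => ENNReal.ofReal (M / ε * (2 * (‖A‖ * R * ‖E‖))) *
        ‖newtonField (x - y)‖ₑ) x := by
    intro x
    rw [hA.fderiv_comp_inner_self hη]
    by_cases hx : x ∈ ellipsoidShell A ε
    · rw [Set.indicator_of_mem hx, enorm_smul, ← ofReal_norm (_ * _ : ℝ)]
      gcongr
      rw [norm_mul, norm_mul, Real.norm_ofNat]
      gcongr
      · exact hd _
      · refine (norm_inner_le_norm _ _).trans ?_
        gcongr
        refine (A.le_opNorm x).trans ?_
        gcongr
        exact (mem_ball_zero_iff.mp (hRB (ellipsoidShell_subset A ε hx))).le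
    · have h00 : deriv η ⟪A x, x⟫ = 0 := by
        have : ⟪A x, x⟫ < 1 - ε ∨ 1 - ε / 2 < ⟪A x, x⟫ := by
          by_contra h
          rw [not_or, not_lt, not_lt] at h
          exact hx ⟨h.1, by linarith⟩
        rcases this with h | h
        · have : η =ᶠ[𝓝 ⟪A x, x⟫] fun _ => 1 := by
            filter_upwards [Iio_mem_nhds h] with s hs using h1 s hs
          rw [this.deriv_eq]; simp
        · have : η =ᶠ[𝓝 ⟪A x, x⟫] fun _ => 0 := by
            filter_upwards [Ioi_mem_nhds h] with s hs using h0 s (le_of_lt hs)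
          rw [this.deriv_eq]; simp
      simp [h00]
  have hle : ‖∫ x, fderiv ℝ (fun x => η ⟪A x, x⟫) x E • newtonField (x - y)‖ₑ ≤
      ENNReal.ofReal (M * (2 * (‖A‖ * R * ‖E‖)) * C / Real.sqrt ε) := by
    calc _ ≤ ∫⁻ x, ‖fderiv ℝ (fun x => η ⟪A x, x⟫) x E • newtonField (x - y)‖ₑ :=
          enorm_integral_le_lintegral_enorm _
      _ ≤ ∫⁻ x in ellipsoidShell A ε, ENNReal.ofReal (M / ε * (2 * (‖A‖ * R * ‖E‖))) *
            ‖newtonField (x - y)‖ₑ := by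
          rw [← lintegral_indicator (measurableSet_ellipsoidShell A ε)]
          exact lintegral_mono hpt
      _ = ENNReal.ofReal (M / ε * (2 * (‖A‖ * R * ‖E‖))) *
            ∫⁻ x in ellipsoidShell A ε, ‖newtonField (x - y)‖ₑ :=
          lintegral_const_mul _ (measurable_newtonField.comp (by fun_prop)).enorm
      _ ≤ ENNReal.ofReal (M / ε * (2 * (‖A‖ * R * ‖E‖))) * ENNReal.ofReal (C * Real.sqrt ε) := by
          gcongr
          exact hshell ε hε.le y
      _ = _ := by
          rw [← ENNReal.ofReal_mul (by positivity)]
          congr 1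
          have hs : 0 < Real.sqrt ε := Real.sqrt_pos.mpr hε
          nth_rewrite 1 [← Real.sq_sqrt hε.le]
          field_simp
  rw [← ofReal_norm] at hle
  exact (ENNReal.ofReal_le_ofReal_iff (by positivity)).mp hle

/-- The mean of an eigenfunction of the static magnetization operator is an eigenvector of the
demagnetization operator. -/
theorem demag_integral_of_isStaticMagnetization
    (hsymm : ∀ x y, ⟪x, demag A y⟫ = ⟪demag A x, y⟫) {φ : E3 → E3} {lam : ℝ}
    (hφ : IsStaticMagnetization (solidEllipsoid A) φ (fun x => lam • φ x)) :
    demag A (∫ x in solidEllipsoid A, φ x) = lam • ∫ x in solidEllipsoid A, φ x := by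
  have : IsFiniteMeasure (volume.restrict (solidEllipsoid A)) :=
    ⟨by simpa using hA.volume_solidEllipsoid_lt_top⟩
  have hB := (isOpen_solidEllipsoid A).measurableSet
  have hφ1 : IntegrableOn φ (solidEllipsoid A) := hφ.1.integrable (by norm_num)
  obtain ⟨M, hM, hcut⟩ := exists_smooth_cutoff
  refine ext_inner_left ℝ fun E => ?_
  rw [hsymm, inner_smul_right, ← integral_inner hφ1, ← integral_inner hφ1, ← sub_eq_zero]
  obtain ⟨N, hN, hW⟩ := hA.exists_norm_integral_fderiv_le E M hM
  -- The three terms of `N` bound, on the shell, the contributions of `demag A E`, of the field W,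
  -- and of the defect 1 - η.
  refine eq_zero_of_forall_le_setIntegral_div_sqrt (S := ellipsoidShell A)
    (V := 3 * volume.real (solidEllipsoid A)) (N := ‖demag A E‖ + N + |lam| * ‖E‖) hφ.1
    (fun ε h0 h1 => ?_) (by positivity) (fun ε h0 h1 => ?_)
  · rw [measureReal_restrict_apply (measurableSet_ellipsoidShell A ε),
      Set.inter_eq_left.mpr (ellipsoidShell_subset A ε)]
    linarith [hA.volume_ellipsoidShell_le h0 h1]
  obtain ⟨η, hη, hη0, hη1, hone, hzero, hd⟩ := hcut ε h0
  have hone' : ∀ t, t < 1 - ε → η t = 1 := fun t ht => hone t ht.le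
  have hηb : ∀ t, |η t| ≤ 1 := fun t => abs_le.mpr ⟨by linarith [hη0 t], hη1 t⟩
  have hψ := contDiff_comp_inner_self A hη
  have hψs := hA.hasCompactSupport_comp_inner_self hzero
  have hψB : tsupport (fun x => η ⟪A x, x⟫) ⊆ solidEllipsoid A :=
    (tsupport_comp_inner_self_subset A hzero).trans fun x hx => by
      have : ⟪A x, x⟫ ≤ 1 - ε / 2 := hx
      exact show ⟪A x, x⟫ < 1 by linarith
  have htest := hA.integral_inner_eq_of_isStaticMagnetization hφ hφ1 hψ hψs hψB E
  set W : E3 → E3 := fun y => ∫ x, fderiv ℝ (fun x => η ⟪A x, x⟫) x E • newtonField (x - y)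
    with hWdef
  have hWb : ∀ y, ‖W y‖ ≤ N / Real.sqrt ε := hW ε η h0 hη hone' hzero hd
  have hWeq : ∀ y, ⟪A y, y⟫ < 1 - ε → W y = demag A E := fun y hy =>
    hA.integral_fderiv_smul_newtonField hη hηb hone' hzero hy E
  have hWm : StronglyMeasurable W := by
    have hg : Measurable fun x => fderiv ℝ (fun x => η ⟪A x, x⟫) x E :=
      ((hψ.continuous_fderiv (by simp)).clm_apply continuous_const).measurable
    refine StronglyMeasurable.integral_prod_right
      (f := fun y x => fderiv ℝ (fun x => η ⟪A x, x⟫) x E • newtonField (x - y)) ?_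
    exact ((hg.comp measurable_snd).smul
      (measurable_newtonField.comp (measurable_snd.sub measurable_fst))).stronglyMeasurable
  have i1 : IntegrableOn (fun y => ⟪W y, φ y⟫) (solidEllipsoid A) := by
    refine Integrable.mono' (hφ1.norm.const_mul (N / Real.sqrt ε))
      (hWm.aestronglyMeasurable.inner hφ1.1) (Filter.Eventually.of_forall fun y => ?_)
    exact (norm_inner_le_norm _ _).trans (by gcongr; exact hWb y)
  have i2 : IntegrableOn (fun y => ⟪demag A E, φ y⟫) (solidEllipsoid A) := hφ1.const_inner _
  have i3 : IntegrableOn (fun y => ⟪E, φ y⟫) (solidEllipsoid A) := hφ1.const_inner _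
  have i4 : IntegrableOn (fun y => η ⟪A y, y⟫ * ⟪E, φ y⟫) (solidEllipsoid A) :=
    i3.bdd_mul (c := 1) hψ.continuous.aestronglyMeasurable
      (Filter.Eventually.of_forall fun y => hηb _)
  -- Subtracting the tested equation makes the integrand vanish off the shell, where W = `demag A E`
  -- and η = 1.
  have e1 : (∫ y in solidEllipsoid A, ⟪demag A E, φ y⟫) - lam * ∫ y in solidEllipsoid A, ⟪E, φ y⟫ =
      ∫ y in solidEllipsoid A, ((⟪demag A E, φ y⟫ - ⟪W y, φ y⟫) -
        lam * (⟪E, φ y⟫ - η ⟪A y, y⟫ * ⟪E, φ y⟫)) := by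
    have h := integral_sub (i2.sub i1) ((i3.sub i4).const_mul lam)
    simp only [Pi.sub_apply] at h
    rw [h, integral_sub i2 i1, integral_const_mul, integral_sub i3 i4, htest]
    ring
  rw [e1, ← Real.norm_eq_abs, ← integral_const_mul, ← integral_indicator (measurableSet_ellipsoidShell A ε)]
  refine norm_integral_le_of_norm_le ((hφ1.norm.const_mul _).indicator
    (measurableSet_ellipsoidShell A ε)) ?_
  refine (ae_restrict_iff' hB).mpr (Filter.Eventually.of_forall fun y hy => ?_)
  have hs : 0 < Real.sqrt ε := Real.sqrt_pos.mpr h0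
  have hs1 : Real.sqrt ε ≤ 1 := Real.sqrt_le_one.mpr h1.le
  by_cases hyS : y ∈ ellipsoidShell A ε
  · rw [Set.indicator_of_mem hyS]
    have hη' : |1 - η ⟪A y, y⟫| ≤ 1 := abs_le.mpr ⟨by linarith [hη1 ⟪A y, y⟫], by
      linarith [hη0 ⟪A y, y⟫]⟩
    calc _ ≤ ‖⟪demag A E, φ y⟫‖ + ‖⟪W y, φ y⟫‖ + |lam| * (|1 - η ⟪A y, y⟫| * ‖⟪E, φ y⟫‖) := by
          refine (norm_sub_le _ _).trans (add_le_add (norm_sub_le _ _) (le_of_eq ?_))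
          rw [← one_sub_mul, norm_mul, norm_mul]; rfl
      _ ≤ ‖demag A E‖ * ‖φ y‖ + N / Real.sqrt ε * ‖φ y‖ + |lam| * (1 * (‖E‖ * ‖φ y‖)) := by
          gcongr
          · exact norm_inner_le_norm _ _
          · exact (norm_inner_le_norm _ _).trans (by gcongr; exact hWb y)
          · exact norm_inner_le_norm _ _
      _ = (‖demag A E‖ + N / Real.sqrt ε + |lam| * ‖E‖) * ‖φ y‖ := by ring
      _ ≤ _ := by
          gcongr
          rw [add_div, add_div]
          gcongr
          · exact le_div_self (norm_nonneg _) hs hs1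
          · exact le_div_self (by positivity) hs hs1
  · have hlt : ⟪A y, y⟫ < 1 - ε := by
      by_contra h
      exact hyS ⟨not_lt.mp h, hy⟩
    rw [Set.indicator_of_notMem hyS, hWeq y hlt, hone' _ hlt]
    simp

end IsElliptic

/-! ### Surface area and solid angle -/

open scoped NNReal in
theorem LipschitzOnWith.euclideanHausdorffMeasure_image_le {X Y : Type*} [EMetricSpace X]
    [MeasurableSpace X] [BorelSpace X] [EMetricSpace Y] [MeasurableSpace Y] [BorelSpace Y]
    {K : ℝ≥0} {f : X → Y} {s : Set X} (h : LipschitzOnWith K f s) (d : ℕ) :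
    μHE[d] (f '' s) ≤ (K : ENNReal) ^ d * μHE[d] s := by
  have h1 := h.hausdorffMeasure_image_le (d := d) (Nat.cast_nonneg d)
  rw [Measure.euclideanHausdorffMeasure_def, Measure.euclideanHausdorffMeasure_def,
    Measure.smul_apply, Measure.smul_apply, ENNReal.smul_def, ENNReal.smul_def, smul_eq_mul,
    smul_eq_mul, mul_left_comm]
  rw [ENNReal.rpow_natCast] at h1
  gcongr

/-- A map that is close to an isometry on `s` changes the two-dimensional measure by little. -/
theorem euclideanHausdorffMeasure_image_of_near_isometry {f : E3 → E3} {s : Set E3} {δ : ℝ}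
    (hδ : 0 < δ) (hδ1 : δ < 1)
    (h : ∀ z ∈ s, ∀ w ∈ s, ‖f z - f w - (z - w)‖ ≤ δ * ‖z - w‖) :
    μHE[2] (f '' s) ≤ ENNReal.ofReal ((1 + δ) ^ 2) * μHE[2] s ∧
      μHE[2] s ≤ ENNReal.ofReal (((1 - δ)⁻¹) ^ 2) * μHE[2] (f '' s) ∧ Set.InjOn f s := by
  have hup : ∀ z ∈ s, ∀ w ∈ s, ‖f z - f w‖ ≤ (1 + δ) * ‖z - w‖ := by
    intro z hz w hw
    have h1 := norm_add_le (f z - f w - (z - w)) (z - w)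
    rw [sub_add_cancel] at h1
    linarith [h z hz w hw]
  have hlow : ∀ z ∈ s, ∀ w ∈ s, ‖z - w‖ ≤ (1 - δ)⁻¹ * ‖f z - f w‖ := by
    intro z hz w hw
    have h1 := norm_sub_le (f z - f w) (f z - f w - (z - w))
    rw [sub_sub_cancel] at h1
    rw [inv_mul_eq_div, le_div_iff₀ (by linarith)]
    linarith [h z hz w hw]
  have hinj : Set.InjOn f s := by
    intro z hz w hw hzw
    have h1 := hlow z hz w hw
    rw [hzw, sub_self, norm_zero, mul_zero] at h1
    exact sub_eq_zero.mp (norm_le_zero_iff.mp h1)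
  have h1δ : 0 < 1 - δ := by linarith
  refine ⟨?_, ?_, hinj⟩
  · have hL : LipschitzOnWith (1 + δ).toNNReal f s := by
      refine LipschitzOnWith.of_dist_le_mul fun z hz w hw => ?_
      rw [dist_eq_norm, dist_eq_norm, Real.coe_toNNReal _ (by positivity)]
      exact hup z hz w hw
    have := hL.euclideanHausdorffMeasure_image_le 2
    rwa [ENNReal.ofReal_pow (by positivity)]
  · have hL : LipschitzOnWith ((1 - δ)⁻¹).toNNReal (Function.invFunOn f s) (f '' s) := by
      refine LipschitzOnWith.of_dist_le_mul ?_
      rintro _ ⟨z, hz, rfl⟩ _ ⟨w, hw, rfl⟩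
      rw [hinj.leftInvOn_invFunOn hz, hinj.leftInvOn_invFunOn hw, dist_eq_norm, dist_eq_norm,
        Real.coe_toNNReal _ (by positivity)]
      exact hlow z hz w hw
    have := hL.euclideanHausdorffMeasure_image_le 2
    rw [hinj.leftInvOn_invFunOn.image_image] at this
    rwa [ENNReal.ofReal_pow (by positivity)]

open Set Pointwise in
/-- The volume of a cone over a flat base. -/
theorem volume_cone_of_flat {n : E3} (hn : ‖n‖ = 1) {h : ℝ} (hh : 0 < h) {Q : Set E3}
    (hQ : MeasurableSet Q) (hQn : ∀ z ∈ Q, ⟪z, n⟫ = h) :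
    volume (Ioo (0 : ℝ) 1 • Q) = ENNReal.ofReal (h / 3) * μHE[2] Q := by
  have hdim : Module.finrank ℝ E3 = 3 := by simp
  have hmem : ∀ w, w ∈ Ioo (0 : ℝ) 1 • Q ↔ (0 < ⟪w, n⟫ ∧ ⟪w, n⟫ < h) ∧ (h / ⟪w, n⟫) • w ∈ Q := by
    intro w
    constructor
    · rintro ⟨t, ht, z, hz, rfl⟩
      have hz' := hQn z hz
      have ht0 := ht.1.ne'
      simp only [inner_smul_left, RCLike.conj_to_real, hz', smul_smul]
      refine ⟨⟨mul_pos ht.1 hh, by nlinarith [ht.2]⟩, ?_⟩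
      have : h / (t * h) * t = 1 := by field_simp
      rwa [this, one_smul]
    · rintro ⟨⟨h1, h2⟩, h3⟩
      refine ⟨⟪w, n⟫ / h, ⟨by positivity, by rwa [div_lt_one hh]⟩, _, h3, ?_⟩
      simp only [smul_smul]
      have : ⟪w, n⟫ / h * (h / ⟪w, n⟫) = 1 := by field_simp
      rw [this, one_smul]
  have hin : Measurable fun w : E3 => ⟪w, n⟫ := by fun_prop
  have hm : MeasurableSet (Ioo (0 : ℝ) 1 • Q) := by
    have : Ioo (0 : ℝ) 1 • Q = {w | (0 < ⟪w, n⟫ ∧ ⟪w, n⟫ < h) ∧ (h / ⟪w, n⟫) • w ∈ Q} :=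
      Set.ext hmem
    rw [this]
    refine ((measurableSet_lt measurable_const hin).inter
      (measurableSet_lt hin measurable_const)).inter (hQ.preimage ?_)
    exact (measurable_const.div hin).smul measurable_id
  have hn0 : n ≠ 0 := by
    rintro rfl; simp at hn
  have hmain := EuclideanGeometry.euclideanHausdorffMeasure_eq_lintegral (0 : E3) hn0 hm
  rw [InnerProductSpace.euclideanHausdorffMeasure_eq_volume, hdim] at hmain
  -- The section at height x is the base scaled by x / h, of area (x / h)² times that of Q;
  -- integrating over (0, h) gives h / 3.
  have hsec : ∀ x : ℝ, μHE[3 - 1] (Ioo (0 : ℝ) 1 • Q ∩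
      (AffineSubspace.mk' (x • n +ᵥ (0 : E3)) (Submodule.span ℝ {n})ᗮ : AffineSubspace ℝ E3)) =
      (Ioo 0 h).indicator (fun x => ENNReal.ofReal (x ^ 2 / h ^ 2) * μHE[2] Q) x := by
    intro x
    have hplane : ∀ w : E3, w ∈ (AffineSubspace.mk' (x • n +ᵥ (0 : E3))
        (Submodule.span ℝ {n})ᗮ : AffineSubspace ℝ E3) ↔ ⟪w, n⟫ = x := by
      intro w
      rw [AffineSubspace.mem_mk', Submodule.mem_orthogonal_singleton_iff_inner_left]
      simp [inner_sub_left, inner_smul_left, hn, sub_eq_zero]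
    by_cases hx : x ∈ Ioo 0 h
    · rw [indicator_of_mem hx]
      have hx0 : x ≠ 0 := hx.1.ne'
      have hs : Ioo (0 : ℝ) 1 • Q ∩ (AffineSubspace.mk' (x • n +ᵥ (0 : E3))
          (Submodule.span ℝ {n})ᗮ : AffineSubspace ℝ E3) = (x / h) • Q := by
        ext w
        rw [mem_inter_iff, SetLike.mem_coe, hplane, hmem,
          mem_smul_set_iff_inv_smul_mem₀ (div_ne_zero hx0 hh.ne'), inv_div]
        constructor
        · rintro ⟨⟨-, h3⟩, rfl⟩; exact h3
        · intro h3
          have h4 := hQn _ h3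
          rw [inner_smul_left, RCLike.conj_to_real] at h4
          have h5 : ⟪w, n⟫ = x := by
            field_simp at h4
            linarith
          rw [h5]
          exact ⟨⟨hx, h3⟩, rfl⟩
      rw [hs, Measure.euclideanHausdorffMeasure_smul₀ _ (div_ne_zero hx0 hh.ne'),
        ENNReal.smul_def, smul_eq_mul]
      congr 1
      rw [← div_pow, ENNReal.ofReal_pow (div_nonneg hx.1.le hh.le), ENNReal.coe_pow]
      congr 1
      rw [← enorm_eq_nnnorm, Real.enorm_of_nonneg (div_nonneg hx.1.le hh.le)]
    · rw [indicator_of_notMem hx]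
      have hs : Ioo (0 : ℝ) 1 • Q ∩ (AffineSubspace.mk' (x • n +ᵥ (0 : E3))
          (Submodule.span ℝ {n})ᗮ : AffineSubspace ℝ E3) = ∅ := by
        refine eq_empty_of_forall_notMem fun w hw => ?_
        rw [mem_inter_iff, SetLike.mem_coe, hplane, hmem] at hw
        obtain ⟨⟨h1, -⟩, rfl⟩ := hw
        exact hx h1
      rw [hs, measure_empty]
  simp only [hsec] at hmain
  have hn1 : ‖n‖ₑ = 1 := by rw [← ofReal_norm, hn, ENNReal.ofReal_one]
  rw [hmain, hn1, one_mul, lintegral_indicator measurableSet_Ioo,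
    lintegral_mul_const _ (by fun_prop)]
  congr 1
  rw [← ofReal_integral_eq_lintegral_ofReal, ← integral_Ioc_eq_integral_Ioo,
    ← intervalIntegral.integral_of_le hh.le, intervalIntegral.integral_div, integral_pow]
  · congr 1
    field_simp
    norm_num
    ring
  · exact (Continuous.integrableOn_Icc (by fun_prop)).mono_set Ioo_subset_Icc_self
  · exact Filter.Eventually.of_forall fun x => by positivity

open Set in
/-- Two measures that are locally comparable with constants arbitrarily close to one are
comparable. -/
theorem measure_le_of_locally_le {X : Type*} [TopologicalSpace X] [SecondCountableTopology X]
    [MeasurableSpace X] [OpensMeasurableSpace X] {μ ν : Measure X} {T : Set X} (k : ℕ)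
    (hloc : ∀ c : ℝ, 1 < c → ∀ z ∈ T, ∃ U ∈ 𝓝 z, ∀ S, MeasurableSet S → S ⊆ U → S ⊆ T →
      μ S ≤ ENNReal.ofReal (c ^ k) * ν S) {S : Set X} (hS : MeasurableSet S) (hST : S ⊆ T) :
    μ S ≤ ν S := by
  have hc : ∀ c : ℝ, 1 < c → μ S ≤ ENNReal.ofReal (c ^ k) * ν S := by
    intro c hc
    rcases S.eq_empty_or_nonempty with rfl | hne
    · simp
    -- Second countability reduces the cover to countably many neighbourhoods; making them disjoint
    -- lets the local inequalities be summed without losing a constant.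
    choose! U hU hUS using hloc c hc
    obtain ⟨t, htT, htc, ht⟩ := TopologicalSpace.countable_cover_nhdsWithin (s := T)
      (f := fun z => interior (U z)) fun z hz =>
        mem_nhdsWithin_of_mem_nhds (interior_mem_nhds.mpr (hU z hz))
    have htne : t.Nonempty := by
      obtain ⟨z, hz⟩ := hne
      obtain ⟨w, hw, -⟩ := mem_iUnion₂.mp (ht (hST hz))
      exact ⟨w, hw⟩
    obtain ⟨g, rfl⟩ := htc.exists_eq_range htne
    have hgT : ∀ i, g i ∈ T := fun i => htT ⟨i, rfl⟩
    set V : ℕ → Set X := fun i => S ∩ disjointed (fun i => interior (U (g i))) i with hV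
    have hVm : ∀ i, MeasurableSet (V i) := fun i =>
      hS.inter (MeasurableSet.disjointed (fun i => isOpen_interior.measurableSet) i)
    have hVd : Pairwise (Function.onFun Disjoint V) := fun i j hij =>
      (disjoint_disjointed _ hij).mono inter_subset_right inter_subset_right
    have hVS : S = ⋃ i, V i := by
      rw [hV, ← inter_iUnion, iUnion_disjointed, eq_comm, inter_eq_left]
      intro z hz
      simpa using ht (hST hz)
    rw [hVS, measure_iUnion hVd hVm, measure_iUnion hVd hVm, ← ENNReal.tsum_mul_left]
    refine ENNReal.tsum_le_tsum fun i => hUS (g i) (hgT i) _ (hVm i) ?_ ?_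
    · exact inter_subset_right.trans ((disjointed_subset _ i).trans interior_subset)
    · exact inter_subset_left.trans hST
  -- The limit c → 1 is taken only for finite ν S; otherwise the claim is trivial.
  rcases eq_or_ne (ν S) ⊤ with htop | htop
  · rw [htop]; exact le_top
  have hlim : Filter.Tendsto (fun c : ℝ => ENNReal.ofReal (c ^ k) * ν S) (𝓝[>] 1) (𝓝 (ν S)) := by
    have h1 : Continuous fun c : ℝ => ENNReal.ofReal (c ^ k) :=
      ENNReal.continuous_ofReal.comp (by fun_prop)
    have h2 := (h1.tendsto 1).mono_left (nhdsWithin_le_nhds (s := Ioi 1))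
    have h3 := ENNReal.Tendsto.mul_const (b := ν S) h2 (Or.inr htop)
    simpa using h3
  exact ge_of_tendsto hlim (by filter_upwards [self_mem_nhdsWithin] with c hc' using hc c hc')

/-- The central projection with vertex `0` onto the plane `{z | ⟪z, n⟫ = h}`. -/
noncomputable def centralProj (n : E3) (h : ℝ) (z : E3) : E3 := (h / ⟪z, n⟫) • z

theorem inner_centralProj {n : E3} {h : ℝ} {z : E3} (hz : ⟪z, n⟫ ≠ 0) :
    ⟪centralProj n h z, n⟫ = h := by
  rw [centralProj, inner_smul_left, RCLike.conj_to_real, div_mul_cancel₀ _ hz]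

/-- Near a point of a level set, the central projection onto the tangent plane is nearly an
isometry of the level set. -/
theorem eventually_centralProj_sub {n z₀ : E3} {h κ : ℝ} (hh : ⟪z₀, n⟫ = h) (hh0 : h ≠ 0)
    {F : E3 → ℝ} (hκ : κ ≠ 0) (hF : HasStrictFDerivAt F (κ • innerSL ℝ n) z₀) {δ : ℝ}
    (hδ : 0 < δ) : ∃ U ∈ 𝓝 z₀, ∀ z ∈ U, ∀ w ∈ U, F z = F w →
      ‖centralProj n h z - centralProj n h w - (z - w)‖ ≤ δ * ‖z - w‖ := by
  have hin : HasStrictFDerivAt (fun z : E3 => ⟪z, n⟫) (innerSL ℝ n) z₀ := by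
    have : (fun z : E3 => ⟪z, n⟫) = innerSL ℝ n := by
      ext z; simp [real_inner_comm]
    rw [this]
    exact (innerSL ℝ n).hasStrictFDerivAt
  have h1 : HasStrictFDerivAt (fun z : E3 => h / ⟪z, n⟫) ((-h⁻¹) • innerSL ℝ n) z₀ := by
    have hd : HasStrictDerivAt (fun t : ℝ => h / t) (-h⁻¹) ⟪z₀, n⟫ := by
      have := (hasStrictDerivAt_inv (x := ⟪z₀, n⟫) (hh ▸ hh0)).const_mul h
      rw [hh] at this ⊢
      refine (this.congr_deriv ?_)
      field_simp
    exact hd.comp_hasStrictFDerivAt (f := fun z : E3 => ⟪z, n⟫) z₀ hin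
  have hp : HasStrictFDerivAt (centralProj n h) ((h / ⟪z₀, n⟫) • ContinuousLinearMap.id ℝ E3 +
      ContinuousLinearMap.smulRight ((-h⁻¹) • innerSL ℝ n : E3 →L[ℝ] ℝ) z₀) z₀ :=
    HasStrictFDerivAt.smul h1 (hasStrictFDerivAt_id (𝕜 := ℝ) z₀)
  -- The projection minus the identity has derivative -h⁻¹⟪n, ·⟫ z₀ at z₀. Adding this multiple of F
  -- z₀ cancels it and does not affect differences between points of one level set. Strict
  -- differentiability with derivative 0 then gives the Lipschitz bound δ.
  have hG : HasStrictFDerivAt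
      (fun z => centralProj n h z - z + ((h⁻¹ * κ⁻¹) * F z) • z₀) (0 : E3 →L[ℝ] E3) z₀ := by
    refine ((hp.sub (hasStrictFDerivAt_id (𝕜 := ℝ) z₀)).add
      ((hF.const_mul (h⁻¹ * κ⁻¹)).smul_const z₀)).congr_fderiv ?_
    ext1 v
    simp [hh, hh0, hκ, smul_smul]
  have hlip := hG.isLittleO.def hδ
  rw [nhds_prod_eq, Filter.eventually_iff, Filter.mem_prod_same_iff] at hlip
  obtain ⟨U, hU, hUl⟩ := hlip
  refine ⟨U, hU, fun z hz w hw hzw => ?_⟩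
  have := hUl (Set.mk_mem_prod hz hw)
  simp only [Set.mem_ofPred_eq, hzw, zero_apply, sub_zero] at this
  have e : centralProj n h z - centralProj n h w - (z - w) = centralProj n h z - z +
      (h⁻¹ * κ⁻¹ * F w) • z₀ - (centralProj n h w - w + (h⁻¹ * κ⁻¹ * F w) • z₀) := by abel
  rw [e]
  exact this

open Set Metric Pointwise in
/-- Local comparison between the solid angle and the surface measure on a level set which is
star-shaped with respect to the origin and parametrized by `θ ↦ Φ θ`, a positive multiple
of `θ`. -/
theorem exists_nhds_toSphere_comparison {F : E3 → ℝ} {Φ : sphere (0 : E3) 1 → E3}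
    (hΦm : Measurable Φ) (hΦ : ∀ θ, Φ θ = ‖Φ θ‖ • (θ : E3)) {l : ℝ}
    (hinv : ∀ z, F z = l → ∃ θ, Φ θ = z) {n z₀ : E3} (hn : ‖n‖ = 1)
    {κ : ℝ} (hκ : κ ≠ 0) (hF : HasStrictFDerivAt F (κ • innerSL ℝ n) z₀) (hpos : 0 < ⟪z₀, n⟫)
    {c : ℝ} (hc : 1 < c) :
    ∃ U ∈ 𝓝 z₀, ∀ S, MeasurableSet S → S ⊆ U → (∀ z ∈ S, F z = l) →
      (volume : Measure E3).toSphere (Φ ⁻¹' S) ≤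
        ENNReal.ofReal (c ^ 5 * (⟪z₀, n⟫ / ‖z₀‖ ^ 3)) * μHE[2] S ∧
      ENNReal.ofReal (⟪z₀, n⟫ / ‖z₀‖ ^ 3) * μHE[2] S ≤
        ENNReal.ofReal (c ^ 5) * (volume : Measure E3).toSphere (Φ ⁻¹' S) := by
  set h := ⟪z₀, n⟫ with hh
  have hz0 : z₀ ≠ 0 := by
    rintro rfl; simp [hh] at hpos
  have hz0n : 0 < ‖z₀‖ := norm_pos_iff.mpr hz0
  have hc0 : 0 < c := by linarith
  obtain ⟨δ, hδ, hδ1, hδc, hδc'⟩ : ∃ δ : ℝ, 0 < δ ∧ δ < 1 ∧ 1 + δ ≤ c ∧ (1 - δ)⁻¹ ≤ c := by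
    -- Chosen so that 1 - δ = 1 / c exactly; then 1 + δ ≤ c follows from c > 1.
    refine ⟨(c - 1) / c / 1, ?_, ?_, ?_, ?_⟩
    · have : 0 < c - 1 := by linarith
      positivity
    · rw [div_one, div_lt_one hc0]; linarith
    · rw [div_one]
      have : (c - 1) / c ≤ c - 1 := div_le_self (by linarith) hc.le
      linarith
    · have : 1 - (c - 1) / c / 1 = c⁻¹ := by field_simp; ring
      rw [this, inv_inv]
  obtain ⟨U₁, hU₁, hiso⟩ := eventually_centralProj_sub hh.symm hpos.ne' hκ hF hδ
  set p := centralProj n h with hp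
  have hp0 : p z₀ = z₀ := by simp [hp, centralProj, ← hh, hpos.ne']
  have hcin : Continuous fun z : E3 => ⟪z, n⟫ := by fun_prop
  have hpc : ContinuousAt p z₀ := by
    refine ContinuousAt.smul (f := fun z : E3 => h / ⟪z, n⟫) ?_ continuousAt_id
    exact continuousAt_const.div hcin.continuousAt hpos.ne'
  have hU₂ : {z : E3 | 0 < ⟪z, n⟫} ∈ 𝓝 z₀ := hcin.continuousAt.eventually (lt_mem_nhds hpos)
  have hU₃ : {z : E3 | ‖z₀‖ / c < ‖p z‖} ∈ 𝓝 z₀ := by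
    refine hpc.norm.eventually (lt_mem_nhds ?_)
    simp only [hp0]; exact div_lt_self hz0n hc
  have hU₄ : {z : E3 | ‖p z‖ < c * ‖z₀‖} ∈ 𝓝 z₀ := by
    refine hpc.norm.eventually (gt_mem_nhds ?_)
    simp only [hp0]; nlinarith
  refine ⟨U₁ ∩ {z : E3 | 0 < ⟪z, n⟫} ∩ {z : E3 | ‖z₀‖ / c < ‖p z‖} ∩ {z : E3 | ‖p z‖ < c * ‖z₀‖},
    Filter.inter_mem (Filter.inter_mem (Filter.inter_mem hU₁ hU₂) hU₃) hU₄,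
    fun S hS hSU hSF => ?_⟩
  have hS1 : S ⊆ U₁ := fun z hz => (hSU hz).1.1.1
  have hS2 : ∀ z ∈ S, 0 < ⟪z, n⟫ := fun z hz => (hSU hz).1.1.2
  have hS3 : ∀ z ∈ S, ‖z₀‖ / c < ‖p z‖ := fun z hz => (hSU hz).1.2
  have hS4 : ∀ z ∈ S, ‖p z‖ < c * ‖z₀‖ := fun z hz => (hSU hz).2
  obtain ⟨hup, hlow, hinj⟩ := euclideanHausdorffMeasure_image_of_near_isometry (f := p) (s := S)
    hδ hδ1 fun z hz w hw => hiso z (hS1 hz) w (hS1 hw) ((hSF z hz).trans (hSF w hw).symm)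
  have hpcont : ContinuousOn p S := by
    intro z hz
    refine ContinuousAt.continuousWithinAt ?_
    refine ContinuousAt.smul (f := fun z : E3 => h / ⟪z, n⟫) ?_ continuousAt_id
    exact continuousAt_const.div hcin.continuousAt (hS2 z hz).ne'
  have hQm : MeasurableSet (p '' S) := hS.image_of_continuousOn_injOn hpcont hinj
  have hQn : ∀ q ∈ p '' S, ⟪q, n⟫ = h := by
    rintro _ ⟨z, hz, rfl⟩
    exact inner_centralProj (hS2 z hz).ne'
  have hcone := volume_cone_of_flat hn hpos hQm hQn
  -- the projection of `Φ θ` is a positive multiple of `θ`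
  have hray : ∀ θ : sphere (0 : E3) 1, Φ θ ∈ S → p (Φ θ) = ‖p (Φ θ)‖ • (θ : E3) := by
    intro θ hθ
    have h1 : 0 < h / ⟪Φ θ, n⟫ := div_pos hpos (hS2 _ hθ)
    have h2 : ‖p (Φ θ)‖ = h / ⟪Φ θ, n⟫ * ‖Φ θ‖ := by
      rw [hp, centralProj, norm_smul, Real.norm_of_nonneg h1.le]
    rw [h2, mul_smul, ← hΦ θ]; rfl
  set Ω := Φ ⁻¹' S with hΩ
  have hΩm : MeasurableSet Ω := hΦm hS
  have hsphere := Measure.toSphere_apply' (volume : Measure E3) hΩm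
  have hdim : Module.finrank ℝ E3 = 3 := by simp
  rw [hdim] at hsphere
  set C := Ioo (0 : ℝ) 1 • (Subtype.val '' Ω : Set E3) with hC
  have hsub1 : Ioo (0 : ℝ) 1 • (p '' S) ⊆ (c * ‖z₀‖) • C := by
    rintro _ ⟨t, ht, _, ⟨z, hz, rfl⟩, rfl⟩
    obtain ⟨θ, rfl⟩ := hinv z (hSF z hz)
    have hpp : 0 < ‖p (Φ θ)‖ := (div_pos hz0n hc0).trans (hS3 _ hz)
    refine ⟨(t * ‖p (Φ θ)‖ / (c * ‖z₀‖)) • (θ : E3),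
      ⟨_, ⟨div_pos (mul_pos ht.1 hpp) (by positivity), ?_⟩, _, ⟨θ, hz, rfl⟩, rfl⟩, ?_⟩
    · rw [div_lt_one (by positivity)]
      nlinarith [ht.1, ht.2, hS4 _ hz]
    · simp only [smul_smul]
      rw [mul_div_cancel₀ _ (by positivity : c * ‖z₀‖ ≠ 0), mul_smul, ← hray θ hz]
  have hsub2 : (‖z₀‖ / c) • C ⊆ Ioo (0 : ℝ) 1 • (p '' S) := by
    rintro _ ⟨_, ⟨t, ht, _, ⟨θ, hz, rfl⟩, rfl⟩, rfl⟩
    have hpp : 0 < ‖p (Φ θ)‖ := (div_pos hz0n hc0).trans (hS3 _ hz)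
    refine ⟨‖z₀‖ / c * t / ‖p (Φ θ)‖, ⟨div_pos (mul_pos (by positivity) ht.1) hpp, ?_⟩, p (Φ θ),
      ⟨_, hz, rfl⟩, ?_⟩
    · rw [div_lt_one hpp]
      have := hS3 _ hz
      have h5 : 0 < ‖z₀‖ / c := by positivity
      nlinarith [ht.1, ht.2]
    · simp only
      rw [smul_smul, ← div_mul_cancel₀ (‖z₀‖ / c * t) hpp.ne', mul_smul _ ‖p (Φ θ)‖, ← hray θ hz,
        div_mul_cancel₀ _ hpp.ne']
  have hv1 := measure_mono (μ := (volume : Measure E3)) hsub1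
  have hv2 := measure_mono (μ := (volume : Measure E3)) hsub2
  rw [Measure.addHaar_smul, hdim, abs_of_pos (by positivity), hcone] at hv1 hv2
  have three : (3 : ENNReal) = ENNReal.ofReal 3 := by simp
  have hmul : ∀ {a b : ℝ} (x : ENNReal), 0 ≤ a → ENNReal.ofReal a * (ENNReal.ofReal b * x) =
      ENNReal.ofReal (a * b) * x := fun x ha => by rw [← mul_assoc, ENNReal.ofReal_mul ha]
  have hσ : (volume : Measure E3).toSphere Ω = ENNReal.ofReal 3 * volume C := by
    rw [hsphere, ← three]; norm_num
  have hCv : volume C = ENNReal.ofReal (1 / 3) * (volume : Measure E3).toSphere Ω := by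
    rw [hσ, hmul _ (by norm_num)]; norm_num
  constructor
  · calc (volume : Measure E3).toSphere Ω
        = ENNReal.ofReal (3 * (‖z₀‖ / c)⁻¹ ^ 3) *
            (ENNReal.ofReal ((‖z₀‖ / c) ^ 3) * volume C) := by
          rw [hmul _ (by positivity), hσ]
          congr 2
          field_simp
      _ ≤ ENNReal.ofReal (3 * (‖z₀‖ / c)⁻¹ ^ 3) * (ENNReal.ofReal (h / 3) *
            (ENNReal.ofReal ((1 + δ) ^ 2) * μHE[2] S)) := by
          refine mul_le_mul_right (hv2.trans ?_) _
          gcongr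
      _ ≤ ENNReal.ofReal (3 * (‖z₀‖ / c)⁻¹ ^ 3) * (ENNReal.ofReal (h / 3) *
            (ENNReal.ofReal (c ^ 2) * μHE[2] S)) := by gcongr
      _ = _ := by
          rw [hmul _ (by positivity), hmul _ (by positivity)]
          congr 2
          field_simp
  · calc ENNReal.ofReal (h / ‖z₀‖ ^ 3) * μHE[2] S
        ≤ ENNReal.ofReal (h / ‖z₀‖ ^ 3) * (ENNReal.ofReal (c ^ 2) * μHE[2] (p '' S)) := by
          gcongr
          refine hlow.trans ?_
          have : 0 ≤ (1 - δ)⁻¹ := inv_nonneg.mpr (by linarith)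
          gcongr
      _ = ENNReal.ofReal (3 * c ^ 2 / ‖z₀‖ ^ 3) * (ENNReal.ofReal (h / 3) * μHE[2] (p '' S)) := by
          rw [hmul _ (by positivity), hmul _ (by positivity)]
          congr 2
          field_simp
      _ ≤ ENNReal.ofReal (3 * c ^ 2 / ‖z₀‖ ^ 3) *
            (ENNReal.ofReal ((c * ‖z₀‖) ^ 3) * volume C) := by gcongr
      _ = _ := by
          rw [hCv, hmul _ (by positivity), hmul _ (by positivity)]
          congr 2
          field_simp

/-! ### Rays from an interior point -/

/-- The discriminant of the equation `⟪A (x + r w), x + r w⟫ = 1` in `r`. -/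
noncomputable def rayDisc (A : E3 →L[ℝ] E3) (x w : E3) : ℝ :=
  ⟪A x, w⟫ ^ 2 + ⟪A w, w⟫ * (1 - ⟪A x, x⟫)

/-- The distance from `x` to the ellipsoid `{y | ⟪A y, y⟫ = 1}` in direction `w`. -/
noncomputable def rayLength (A : E3 →L[ℝ] E3) (x w : E3) : ℝ :=
  (-⟪A x, w⟫ + Real.sqrt (rayDisc A x w)) / ⟪A w, w⟫

/-- The density of the solid angle seen from `x` with respect to the surface measure of the
ellipsoid, in terms of the position relative to `x`. -/
noncomputable def solidAngleDensity (A : E3 →L[ℝ] E3) (x z : E3) : ℝ :=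
  ⟪z, A (x + z)⟫ / (‖A (x + z)‖ * ‖z‖ ^ 3)

theorem rayDisc_neg (A : E3 →L[ℝ] E3) (x w : E3) : rayDisc A x (-w) = rayDisc A x w := by
  simp [rayDisc]

namespace IsElliptic

variable {A : E3 →L[ℝ] E3} (hA : IsElliptic A) {x : E3} (hx : x ∈ solidEllipsoid A)
include hA hx

/-- For interior x the quadratic equation along the ray has negative constant term, so its roots
have opposite signs and `rayLength` is the positive one. -/
theorem sq_lt_rayDisc {w : E3} (hw : w ≠ 0) : ⟪A x, w⟫ ^ 2 < rayDisc A x w := by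
  have h1 := hA.inner_self_pos hw
  have h2 : ⟪A x, x⟫ < 1 := hx
  unfold rayDisc
  nlinarith [mul_pos h1 (sub_pos.mpr h2)]

theorem abs_lt_sqrt_rayDisc {w : E3} (hw : w ≠ 0) : |⟪A x, w⟫| < Real.sqrt (rayDisc A x w) :=
  Real.lt_sqrt_of_sq_lt (by rw [sq_abs]; exact hA.sq_lt_rayDisc hx hw)

theorem sqrt_rayDisc_pos {w : E3} (hw : w ≠ 0) : 0 < Real.sqrt (rayDisc A x w) :=
  (abs_nonneg _).trans_lt (hA.abs_lt_sqrt_rayDisc hx hw)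

theorem rayLength_pos {w : E3} (hw : w ≠ 0) : 0 < rayLength A x w := by
  refine div_pos ?_ (hA.inner_self_pos hw)
  have := hA.abs_lt_sqrt_rayDisc hx hw
  have := le_abs_self ⟪A x, w⟫
  linarith

omit hx in
theorem inner_mul_rayLength_add {w : E3} (hw : w ≠ 0) :
    ⟪A w, w⟫ * rayLength A x w + ⟪A x, w⟫ = Real.sqrt (rayDisc A x w) := by
  have := (hA.inner_self_pos hw).ne'
  rw [rayLength]
  field_simp
  ring

theorem inner_self_add_rayLength {w : E3} (hw : w ≠ 0) :
    ⟪A (x + rayLength A x w • w), x + rayLength A x w • w⟫ = 1 := by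
  have h1 := hA.inner_mul_rayLength_add (x := x) hw
  have h2 : (Real.sqrt (rayDisc A x w)) ^ 2 = rayDisc A x w :=
    Real.sq_sqrt ((sq_nonneg _).trans (hA.sq_lt_rayDisc hx hw).le)
  rw [← h1, rayDisc] at h2
  rw [hA.inner_add_smul]
  have h3 := (hA.inner_self_pos hw).ne'
  refine mul_left_cancel₀ h3 ?_
  linear_combination h2

-- Half the derivative of the ray quadratic at its larger root. The value is even in w, which is
-- what makes the antipodal cancellation in `dyadicL_eq_integral` work.
omit hx in
theorem inner_normal_rayLength {w : E3} (hw : w ≠ 0) :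
    ⟪w, A (x + rayLength A x w • w)⟫ = Real.sqrt (rayDisc A x w) := by
  rw [← hA.inner_mul_rayLength_add hw, map_add, map_smul, inner_add_right, inner_smul_right,
    real_inner_comm w (A x), real_inner_comm w (A w)]
  ring

open Metric in
theorem exists_rayLength_smul_eq {z : E3} (hz : ⟪A (x + z), x + z⟫ = 1) :
    ∃ θ : sphere (0 : E3) 1, rayLength A x θ • (θ : E3) = z := by
  have hx1 : ⟪A x, x⟫ < 1 := hx
  have hz0 : z ≠ 0 := by
    rintro rfl
    rw [add_zero] at hz
    exact hx1.ne hz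
  have hn : 0 < ‖z‖ := norm_pos_iff.mpr hz0
  set w : E3 := ‖z‖⁻¹ • z with hw
  have hw1 : ‖w‖ = 1 := by rw [hw, norm_smul, norm_inv, norm_norm, inv_mul_cancel₀ hn.ne']
  have hw0 : w ≠ 0 := by
    intro h; rw [h, norm_zero] at hw1; exact zero_ne_one hw1
  have hzw : z = ‖z‖ • w := by rw [hw, smul_smul, mul_inv_cancel₀ hn.ne', one_smul]
  refine ⟨⟨w, by simpa using hw1⟩, ?_⟩
  simp only
  have ha := hA.inner_self_pos hw0
  have hlen : rayLength A x w = ‖z‖ := by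
    rw [hzw, hA.inner_add_smul] at hz
    have hsq : (⟪A w, w⟫ * ‖z‖ + ⟪A x, w⟫) ^ 2 = rayDisc A x w := by
      rw [rayDisc]
      linear_combination ⟪A w, w⟫ * hz
    have hs := hA.abs_lt_sqrt_rayDisc hx hw0
    have hb := neg_abs_le ⟪A x, w⟫
    -- A negative value would select the other root: then √disc would be smaller than -⟪A x, w⟫,
    -- against |⟪A x, w⟫| < √disc.
    have hpos : 0 ≤ ⟪A w, w⟫ * ‖z‖ + ⟪A x, w⟫ := by
      by_contra hneg
      have h1 : Real.sqrt (rayDisc A x w) = -(⟪A w, w⟫ * ‖z‖ + ⟪A x, w⟫) := by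
        rw [← hsq, Real.sqrt_sq_eq_abs, abs_of_neg (not_le.mp hneg)]
      have h2 := mul_pos ha hn
      have h3 := neg_le_abs ⟪A x, w⟫
      linarith
    have h1 : Real.sqrt (rayDisc A x w) = ⟪A w, w⟫ * ‖z‖ + ⟪A x, w⟫ := by
      rw [← hsq, Real.sqrt_sq hpos]
    rw [rayLength, h1]
    field_simp
    ring
  rw [hlen, ← hzw]

theorem inner_normal_pos {z : E3} (hz : ⟪A (x + z), x + z⟫ = 1) : 0 < ⟪z, A (x + z)⟫ := by
  obtain ⟨θ, rfl⟩ := hA.exists_rayLength_smul_eq hx hz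
  have hθ : (θ : E3) ≠ 0 := Metric.ne_of_mem_sphere θ.2 one_ne_zero
  rw [inner_smul_left, RCLike.conj_to_real, hA.inner_normal_rayLength hθ]
  exact mul_pos (hA.rayLength_pos hx hθ) (hA.sqrt_rayDisc_pos hx hθ)

omit hA hx in
theorem continuous_rayDisc : Continuous (rayDisc A x) := by
  unfold rayDisc; fun_prop

omit hx in
open Metric in
theorem continuous_rayLength : Continuous fun θ : sphere (0 : E3) 1 => rayLength A x θ := by
  unfold rayLength
  refine Continuous.div ?_ (by fun_prop) fun θ => (hA.inner_sphere_pos θ).ne'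
  exact (by fun_prop : Continuous fun θ : sphere (0 : E3) 1 => -⟪A x, (θ : E3)⟫).add
    (Real.continuous_sqrt.comp (continuous_rayDisc.comp continuous_subtype_val))

omit hx in
theorem hasStrictFDerivAt_inner_self_add (x z : E3) :
    HasStrictFDerivAt (fun z => ⟪A (x + z), x + z⟫) ((2 : ℝ) • innerSL ℝ (A (x + z))) z := by
  have h1 : HasStrictFDerivAt (fun x => ⟪A x, x⟫) ((2 : ℝ) • innerSL ℝ (A (x + z))) (x + z) := by
    have hc : ContDiff ℝ 1 fun x => ⟪A x, x⟫ := A.contDiff.inner ℝ contDiff_id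
    exact hc.contDiffAt.hasStrictFDerivAt' (hA.hasFDerivAt_inner_self (x + z)) one_ne_zero
  have h2 : HasStrictFDerivAt (fun z => x + z) (ContinuousLinearMap.id ℝ E3) z :=
    (hasStrictFDerivAt_id (𝕜 := ℝ) z).const_add x
  exact h1.comp z h2

open Set Metric in
/-- The solid angle seen from `x` as a measure on the surface of the ellipsoid. -/
theorem map_toSphere_rayLength :
    Measure.map (fun θ : sphere (0 : E3) 1 => rayLength A x θ • (θ : E3))
        (volume : Measure E3).toSphere =
      ((μHE[2] : Measure E3).restrict {z | ⟪A (x + z), x + z⟫ = 1}).withDensity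
        fun z => ENNReal.ofReal (solidAngleDensity A x z) := by
  set T : Set E3 := {z | ⟪A (x + z), x + z⟫ = 1} with hT
  set Φ : sphere (0 : E3) 1 → E3 := fun θ => rayLength A x θ • (θ : E3) with hΦ
  have hθ0 : ∀ θ : sphere (0 : E3) 1, (θ : E3) ≠ 0 := fun θ => ne_of_mem_sphere θ.2 one_ne_zero
  have hΦm : Measurable Φ := (hA.continuous_rayLength.smul continuous_subtype_val).measurable
  have hTm : MeasurableSet T := (isClosed_eq (by fun_prop) continuous_const).measurableSet
  have hΦT : ∀ θ, Φ θ ∈ T := fun θ => hA.inner_self_add_rayLength hx (hθ0 θ)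
  have hΦn : ∀ θ, Φ θ = ‖Φ θ‖ • (θ : E3) := fun θ => by
    have h1 : ‖(θ : E3)‖ = 1 := by simp
    have h2 : ‖Φ θ‖ = rayLength A x θ := by
      rw [hΦ, norm_smul, h1, mul_one, Real.norm_of_nonneg (hA.rayLength_pos hx (hθ0 θ)).le]
    rw [h2]
  set ν := (μHE[2] : Measure E3).withDensity fun z => ENNReal.ofReal (solidAngleDensity A x z)
    with hν
  -- The exponent 6 is 5 for the comparison with the density frozen at z, plus 1 for the oscillation
  -- of the density near z.
  have hloc : ∀ c : ℝ, 1 < c → ∀ z ∈ T, ∃ U ∈ 𝓝 z, ∀ S, MeasurableSet S → S ⊆ U → S ⊆ T →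
      Measure.map Φ (volume : Measure E3).toSphere S ≤ ENNReal.ofReal (c ^ 6) * ν S ∧
      ν S ≤ ENNReal.ofReal (c ^ 6) * Measure.map Φ (volume : Measure E3).toSphere S := by
    intro c hc z hz
    have hc0 : 0 < c := by linarith
    have hzN := hA.inner_normal_pos hx hz
    have hN0 : 0 < ‖A (x + z)‖ := norm_pos_iff.mpr fun h => by
      rw [h, inner_zero_right] at hzN; exact hzN.false
    have hz0 : 0 < ‖z‖ := norm_pos_iff.mpr fun h => by
      rw [h, inner_zero_left] at hzN; exact hzN.false
    set n : E3 := ‖A (x + z)‖⁻¹ • A (x + z) with hn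
    have hn1 : ‖n‖ = 1 := by rw [hn, norm_smul, norm_inv, norm_norm, inv_mul_cancel₀ hN0.ne']
    have hzn : ⟪z, n⟫ / ‖z‖ ^ 3 = solidAngleDensity A x z := by
      rw [hn, inner_smul_right, solidAngleDensity]
      field_simp
    have hρ : 0 < solidAngleDensity A x z := by
      unfold solidAngleDensity; positivity
    have hF : HasStrictFDerivAt (fun z => ⟪A (x + z), x + z⟫)
        ((2 * ‖A (x + z)‖) • innerSL ℝ n) z := by
      refine (hA.hasStrictFDerivAt_inner_self_add x z).congr_fderiv ?_
      ext v
      simp only [hn, map_smul, smul_apply, smul_eq_mul]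
      field_simp
    obtain ⟨U, hU, hUS⟩ := exists_nhds_toSphere_comparison (l := 1) hΦm hΦn
      (fun w hw => hA.exists_rayLength_smul_eq hx hw) hn1 (by positivity) hF
      (by rw [hn, inner_smul_right]; positivity) hc
    rw [hzn] at hUS
    have hρc : ContinuousAt (solidAngleDensity A x) z := by
      unfold solidAngleDensity
      exact ContinuousAt.div (by fun_prop) (by fun_prop) (by positivity)
    have hV : {w | solidAngleDensity A x z / c < solidAngleDensity A x w ∧
        solidAngleDensity A x w < c * solidAngleDensity A x z} ∈ 𝓝 z :=
      (hρc.eventually (lt_mem_nhds (div_lt_self hρ hc))).and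
        (hρc.eventually (gt_mem_nhds (by nlinarith)))
    refine ⟨U ∩ _, Filter.inter_mem hU hV, fun S hS hSU hST => ?_⟩
    obtain ⟨h1, h2⟩ := hUS S hS (fun w hw => (hSU hw).1) fun w hw => hST hw
    rw [Measure.map_apply hΦm hS, hν, withDensity_apply _ hS]
    have hlow : ENNReal.ofReal (solidAngleDensity A x z / c) * μHE[2] S ≤
        ∫⁻ w in S, ENNReal.ofReal (solidAngleDensity A x w) ∂μHE[2] := by
      rw [← setLIntegral_const]
      exact setLIntegral_mono' hS fun w hw => ENNReal.ofReal_le_ofReal (hSU hw).2.1.le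
    have hup : ∫⁻ w in S, ENNReal.ofReal (solidAngleDensity A x w) ∂μHE[2] ≤
        ENNReal.ofReal (c * solidAngleDensity A x z) * μHE[2] S := by
      rw [← setLIntegral_const]
      exact setLIntegral_mono' hS fun w hw => ENNReal.ofReal_le_ofReal (hSU hw).2.2.le
    constructor
    · refine h1.trans ?_
      refine le_trans (le_of_eq ?_) (mul_le_mul_right hlow _)
      rw [← mul_assoc, ← ENNReal.ofReal_mul (by positivity)]
      congr 2
      field_simp
    · refine hup.trans ?_
      rw [ENNReal.ofReal_mul hc0.le, mul_assoc]
      refine (mul_le_mul_right h2 _).trans (le_of_eq ?_)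
      rw [← mul_assoc, ← ENNReal.ofReal_mul hc0.le]
      congr 2
      ring
  ext S hS
  have e1 : Measure.map Φ (volume : Measure E3).toSphere S =
      Measure.map Φ (volume : Measure E3).toSphere (S ∩ T) := by
    rw [Measure.map_apply hΦm hS, Measure.map_apply hΦm (hS.inter hTm), preimage_inter,
      (eq_univ_of_forall hΦT : Φ ⁻¹' T = univ), inter_univ]
  have e2 : (((μHE[2] : Measure E3).restrict T).withDensity
      fun z => ENNReal.ofReal (solidAngleDensity A x z)) S = ν (S ∩ T) := by
    rw [withDensity_apply _ hS, hν, withDensity_apply _ (hS.inter hTm), Measure.restrict_restrict hS]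
  rw [e1, e2]
  refine le_antisymm ?_ ?_
  · exact measure_le_of_locally_le 6 (fun c hc z hz => by
      obtain ⟨U, hU, h⟩ := hloc c hc z hz
      exact ⟨U, hU, fun S h1 h2 h3 => (h S h1 h2 h3).1⟩) (hS.inter hTm) inter_subset_right
  · exact measure_le_of_locally_le 6 (fun c hc z hz => by
      obtain ⟨U, hU, h⟩ := hloc c hc z hz
      exact ⟨U, hU, fun S h1 h2 h3 => (h S h1 h2 h3).2⟩) (hS.inter hTm) inter_subset_right

end IsElliptic

/-! ### The surface matrix as an average over directions -/

theorem frontier_solidEllipsoid (A : E3 →L[ℝ] E3) :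
    frontier (solidEllipsoid A) = {y | ⟪A y, y⟫ = 1} := by
  refine Set.Subset.antisymm (frontier_lt_subset_eq (by fun_prop) continuous_const) fun y hy => ?_
  have hy1 : ⟪A y, y⟫ = 1 := hy
  rw [(isOpen_solidEllipsoid A).frontier_eq]
  refine ⟨?_, fun h => (show ⟪A y, y⟫ < 1 from h).ne hy1⟩
  have hc : Filter.Tendsto (fun t : ℝ => t • y) (𝓝[<] 1) (𝓝 y) := by
    have : Continuous fun t : ℝ => t • y := by fun_prop
    simpa using (this.tendsto 1).mono_left nhdsWithin_le_nhds
  refine mem_closure_of_tendsto hc ?_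
  filter_upwards [Ioo_mem_nhdsLT (zero_lt_one (α := ℝ))] with t ht
  show ⟪A (t • y), t • y⟫ < 1
  simp only [map_smul, inner_smul_left, inner_smul_right, RCLike.conj_to_real, hy1]
  nlinarith [ht.1, ht.2]

namespace IsElliptic

variable {A : E3 →L[ℝ] E3} (hA : IsElliptic A)
include hA

theorem outwardUnitNormal_solidEllipsoid {y : E3} (hy : ⟪A y, y⟫ = 1) :
    outwardUnitNormal (solidEllipsoid A) y = ‖A y‖⁻¹ • A y := by
  have hN : 0 < ‖A y‖ := norm_pos_iff.mpr fun h => by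
    rw [h, inner_zero_left] at hy; exact zero_ne_one hy
  have hexp : ∀ z, ⟪A z, z⟫ = ⟪A (z - y), z - y⟫ + 2 * ⟪z - y, A y⟫ + 1 := by
    intro z
    have := hA.inner_add_smul y (z - y) 1
    rw [one_smul, add_sub_cancel, hy, real_inner_comm] at this
    rw [real_inner_comm, this, real_inner_comm (A y)]
    ring
  have hnormal : IsOutwardUnitNormal (solidEllipsoid A) y (‖A y‖⁻¹ • A y) := by
    refine ⟨by rw [norm_smul, norm_inv, norm_norm, inv_mul_cancel₀ hN.ne'], fun ε hε => ?_⟩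
    -- By `hexp`, ⟪z - y, A y⟫ is nonpositive inside and at least -‖A‖‖z - y‖² / 2 outside. This
    -- radius makes the latter at least -ε‖A y‖‖z - y‖.
    have hr : 0 < 2 * ε * ‖A y‖ / (‖A‖ + 1) := by positivity
    filter_upwards [Metric.ball_mem_nhds y hr] with z hz
    rw [Metric.mem_ball, dist_eq_norm, lt_div_iff₀ (by positivity)] at hz
    rw [inner_smul_right]
    have h0 := norm_nonneg (z - y)
    constructor
    · intro hzB
      have h1 : ⟪A z, z⟫ < 1 := hzB
      have h2 := hA.inner_self_nonneg (z - y)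
      rw [hexp] at h1
      have h3 : ⟪z - y, A y⟫ ≤ 0 := by linarith
      exact (mul_nonpos_of_nonneg_of_nonpos (by positivity) h3).trans (by positivity)
    · intro hzB
      have h1 : 1 ≤ ⟪A z, z⟫ := not_lt.mp hzB
      rw [hexp] at h1
      have h2 : ⟪A (z - y), z - y⟫ ≤ ‖A‖ * ‖z - y‖ * ‖z - y‖ :=
        (real_inner_le_norm _ _).trans (by gcongr; exact A.le_opNorm _)
      rw [inv_mul_eq_div, le_div_iff₀ hN]
      nlinarith [mul_le_mul_of_nonneg_right hz.le h0, mul_nonneg h0 h0]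
  have hex : ∃ n, IsOutwardUnitNormal (solidEllipsoid A) y n := ⟨_, hnormal⟩
  rw [outwardUnitNormal, dif_pos hex]
  exact hex.choose_spec.unique hnormal

open Set Metric in
/-- The matrix `L_B(x)` as an integral over directions. -/
theorem dyadicL_eq_integral_ray {x : E3} (hx : x ∈ solidEllipsoid A) (i j : Fin 3) :
    dyadicL (solidEllipsoid A) x i j = ∫ θ : sphere (0 : E3) 1,
      (4 * Real.pi)⁻¹ * ((θ : E3) i * (A (x + rayLength A x θ • (θ : E3))) j /
        Real.sqrt (rayDisc A x θ)) ∂(volume : Measure E3).toSphere := by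
  set T : Set E3 := {z | ⟪A (x + z), x + z⟫ = 1} with hT
  have hTm : MeasurableSet T := (isClosed_eq (by fun_prop) continuous_const).measurableSet
  -- The surface integrand divided by the solid angle density. The powers of ‖z‖ and the norm of the
  -- normal cancel, and g is homogeneous of degree 0 apart from the argument x + z of A.
  set g : E3 → ℝ := fun z => (4 * Real.pi)⁻¹ * (z i * A (x + z) j / ⟪z, A (x + z)⟫) with hg
  have hgm : Measurable g := by
    have h1 : Measurable fun z : E3 => z i := by fun_prop
    have h2 : Measurable fun z : E3 => A (x + z) j := by fun_prop
    have h3 : Measurable fun z : E3 => ⟪z, A (x + z)⟫ := by fun_prop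
    exact measurable_const.mul ((h1.mul h2).div h3)
  have hρm : Measurable fun z => (solidAngleDensity A x z).toNNReal := by
    refine Measurable.real_toNNReal ?_
    unfold solidAngleDensity
    exact (Measurable.div (by fun_prop) (by fun_prop))
  have e1 : dyadicL (solidEllipsoid A) x i j =
      ∫ z in T, (solidAngleDensity A x z).toNNReal • g z ∂μHE[2] := by
    have hpre : (fun z => x + z) ⁻¹' frontier (solidEllipsoid A) = T := by
      rw [frontier_solidEllipsoid]; rfl
    rw [dyadicL, Matrix.of_apply,
      ← (measurePreserving_add_left (μHE[2] : Measure E3) x).setIntegral_preimage_emb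
        (measurableEmbedding_addLeft x), hpre]
    refine setIntegral_congr_fun hTm fun z hz => ?_
    have hzN := hA.inner_normal_pos hx hz
    have hN0 : 0 < ‖A (x + z)‖ := norm_pos_iff.mpr fun h => by
      rw [h, inner_zero_right] at hzN; exact hzN.false
    have hz0 : 0 < ‖z‖ := norm_pos_iff.mpr fun h => by
      rw [h, inner_zero_left] at hzN; exact hzN.false
    have hρ : 0 < solidAngleDensity A x z := by
      unfold solidAngleDensity; positivity
    have hsub : x - (x + z) = -z := by abel
    simp only [NNReal.smul_def, Real.coe_toNNReal _ hρ.le, hg, gradGreen_eq, hsub,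
      newtonField_neg, hA.outwardUnitNormal_solidEllipsoid hz]
    simp only [newtonField, neg_neg, PiLp.smul_apply, smul_eq_mul, solidAngleDensity]
    field_simp
  have e2 := integral_withDensity_eq_integral_smul (μ := (μHE[2] : Measure E3).restrict T) hρm g
  have hmap := hA.map_toSphere_rayLength hx
  have hΦm : Measurable fun θ : sphere (0 : E3) 1 => rayLength A x θ • (θ : E3) :=
    (hA.continuous_rayLength.smul continuous_subtype_val).measurable
  rw [e1, ← e2]
  have : ((μHE[2] : Measure E3).restrict T).withDensity
      (fun z => ((solidAngleDensity A x z).toNNReal : ENNReal)) =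
      Measure.map (fun θ : sphere (0 : E3) 1 => rayLength A x θ • (θ : E3))
        (volume : Measure E3).toSphere := hmap.symm
  rw [this, integral_map hΦm.aemeasurable hgm.aestronglyMeasurable]
  refine integral_congr_ae (Filter.Eventually.of_forall fun θ => ?_)
  have hθ0 : (θ : E3) ≠ 0 := ne_of_mem_sphere θ.2 one_ne_zero
  have hr := (hA.rayLength_pos hx hθ0).ne'
  have hs := (hA.sqrt_rayDisc_pos hx hθ0).ne'
  simp only [hg, PiLp.smul_apply, smul_eq_mul, inner_smul_left, RCLike.conj_to_real,
    hA.inner_normal_rayLength hθ0]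
  field_simp

open Set Metric in
/-- The matrix `L_B(x)` does not depend on `x`. -/
theorem dyadicL_eq_integral {x : E3} (hx : x ∈ solidEllipsoid A) (i j : Fin 3) :
    dyadicL (solidEllipsoid A) x i j = ∫ θ : sphere (0 : E3) 1,
      (4 * Real.pi)⁻¹ * ((θ : E3) i * A θ j / ⟪A θ, (θ : E3)⟫)
        ∂(volume : Measure E3).toSphere := by
  rw [hA.dyadicL_eq_integral_ray hx]
  set G : E3 → ℝ := fun w => (4 * Real.pi)⁻¹ * (w i * (A (x + rayLength A x w • w)) j /
        Real.sqrt (rayDisc A x w)) with hG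
  have hGi : Integrable (fun θ : sphere (0 : E3) 1 => G θ) (volume : Measure E3).toSphere := by
    refine Continuous.integrable_of_hasCompactSupport ?_ (HasCompactSupport.of_compactSpace _)
    have h1 := hA.continuous_rayLength (x := x)
    have h2 : Continuous fun θ : sphere (0 : E3) 1 => Real.sqrt (rayDisc A x θ) :=
      Real.continuous_sqrt.comp (continuous_rayDisc.comp continuous_subtype_val)
    have h3 : Continuous fun θ : sphere (0 : E3) 1 => (θ : E3) i := by fun_prop
    have h4 : Continuous fun θ : sphere (0 : E3) 1 =>
        (A (x + rayLength A x θ • (θ : E3))) j := by fun_prop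
    exact continuous_const.mul ((h3.mul h4).div h2 fun θ =>
      (hA.sqrt_rayDisc_pos hx (ne_of_mem_sphere θ.2 one_ne_zero)).ne')
  have hneg := integrable_sphere_neg G hGi
  have e := integral_sphere_neg G
  -- Under θ ↦ -θ the part with A x is odd and cancels. The part with A θ is multiplied by the sum
  -- of the two opposite ray lengths, 2√disc / ⟪A θ, θ⟫, whose root cancels the denominator, and x
  -- disappears.
  have e2 : (2 : ℝ) * ∫ θ : sphere (0 : E3) 1, G θ ∂(volume : Measure E3).toSphere =
      2 * ∫ θ : sphere (0 : E3) 1, (4 * Real.pi)⁻¹ * ((θ : E3) i * A θ j / ⟪A θ, (θ : E3)⟫)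
        ∂(volume : Measure E3).toSphere := by
    rw [two_mul]
    conv_lhs => rhs; rw [← e]
    rw [← integral_add hGi hneg, ← integral_const_mul]
    refine integral_congr_ae (Filter.Eventually.of_forall fun θ => ?_)
    have hθ0 : (θ : E3) ≠ 0 := ne_of_mem_sphere θ.2 one_ne_zero
    have hs := (hA.sqrt_rayDisc_pos hx hθ0).ne'
    have ha := (hA.inner_sphere_pos θ).ne'
    simp only [hG, rayDisc_neg, rayLength, map_add, map_smul, map_neg, inner_neg_left,
      inner_neg_right, neg_neg, PiLp.add_apply, PiLp.smul_apply, PiLp.neg_apply, smul_eq_mul]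
    field_simp
    ring
  exact mul_left_cancel₀ two_ne_zero e2

open Set Metric in
/-- The matrix `L_B(x)` represents the demagnetization operator. -/
theorem toEuclideanLin_dyadicL {x : E3} (hx : x ∈ solidEllipsoid A) (E : E3) :
    Matrix.toEuclideanLin (dyadicL (solidEllipsoid A) x) E = demag A E := by
  ext i
  have h1 : (demag A E) i = ∫ θ : sphere (0 : E3) 1,
      (((4 * Real.pi)⁻¹ * (⟪A θ, E⟫ / ⟪A θ, (θ : E3)⟫)) • (θ : E3)) i
        ∂(volume : Measure E3).toSphere :=
    ((EuclideanSpace.proj i : E3 →L[ℝ] ℝ).integral_comp_comm (hA.integrable_demag E)).symm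
  have hi : ∀ j, Integrable (fun θ : sphere (0 : E3) 1 =>
      (4 * Real.pi)⁻¹ * ((θ : E3) i * A θ j / ⟪A θ, (θ : E3)⟫))
        (volume : Measure E3).toSphere := by
    intro j
    refine Continuous.integrable_of_hasCompactSupport ?_ (HasCompactSupport.of_compactSpace _)
    have h3 : Continuous fun θ : sphere (0 : E3) 1 => (θ : E3) i := by fun_prop
    have h4 : Continuous fun θ : sphere (0 : E3) 1 => A θ j := by fun_prop
    exact continuous_const.mul ((h3.mul h4).div (by fun_prop) fun θ => (hA.inner_sphere_pos θ).ne')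
  rw [h1, Matrix.toLpLin_apply]
  simp only [Matrix.mulVec, dotProduct, hA.dyadicL_eq_integral hx]
  simp only [← integral_mul_const]
  rw [← integral_finsetSum _ fun j _ => (hi j).mul_const _]
  refine integral_congr_ae (Filter.Eventually.of_forall fun θ => ?_)
  simp only [PiLp.smul_apply, smul_eq_mul, PiLp.inner_apply, RCLike.inner_apply, conj_trivial,
    Fin.sum_univ_three]
  ring

end IsElliptic

/-! ### Reduction to quadratic forms and conclusion -/

/-- Every centered ellipsoid is a sublevel set of a positive definite quadratic form that is
diagonal in an orthonormal basis. -/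
theorem IsCenteredEllipsoid.exists_isElliptic {B : Set E3} (hB : IsCenteredEllipsoid B) :
    ∃ (A : E3 →L[ℝ] E3) (b : OrthonormalBasis (Fin 3) ℝ E3) (α : Fin 3 → ℝ), IsElliptic A ∧
      (∀ i, A (b i) = α i • b i) ∧ B = solidEllipsoid A := by
  obtain ⟨b, a, ha, rfl⟩ := hB
  set A : E3 →L[ℝ] E3 := ∑ i, ContinuousLinearMap.smulRight (innerSL ℝ (b i) : E3 →L[ℝ] ℝ)
    (((a i) ^ 2)⁻¹ • b i) with hAdef
  have hA : ∀ x, A x = ∑ i, (⟪b i, x⟫ * ((a i) ^ 2)⁻¹) • b i := by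
    intro x
    simp [hAdef, smul_smul]
  have hin : ∀ x y, ⟪A x, y⟫ = ∑ i, ⟪b i, x⟫ * ((a i) ^ 2)⁻¹ * ⟪b i, y⟫ := by
    intro x y
    rw [hA, sum_inner]
    simp only [inner_smul_left, RCLike.conj_to_real]
  refine ⟨A, b, fun i => ((a i) ^ 2)⁻¹, ⟨fun x y => ?_, ?_⟩, fun i => ?_, ?_⟩
  · rw [real_inner_comm (A y) x, hin, hin]
    exact Finset.sum_congr rfl fun i _ => by ring
  · have hpos : 0 < ∑ i, (a i) ^ 2 := Finset.sum_pos (fun i _ => pow_pos (ha i) 2) (by simp)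
    -- A lower bound for every eigenvalue 1 / (a i)², cruder than the smallest one but free of a
    -- minimum.
    refine ⟨(∑ i, (a i) ^ 2)⁻¹, inv_pos.mpr hpos, fun x => ?_⟩
    rw [hin, ← b.sum_sq_norm_inner_right, Finset.mul_sum]
    refine Finset.sum_le_sum fun i _ => ?_
    have h1 : (a i) ^ 2 ≤ ∑ i, (a i) ^ 2 :=
      Finset.single_le_sum (f := fun i => (a i) ^ 2) (fun i _ => sq_nonneg _) (Finset.mem_univ i)
    have h2 := inv_anti₀ (pow_pos (ha i) 2) h1
    rw [Real.norm_eq_abs, sq_abs]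
    nlinarith [mul_le_mul_of_nonneg_right h2 (sq_nonneg ⟪b i, x⟫)]
  · rw [hA, Finset.sum_eq_single i]
    · simp
    · intro j _ hj
      rw [b.orthonormal.2 hj, zero_mul, zero_smul]
    · simp
  · ext x
    simp only [solidEllipsoid, Set.mem_ofPred_eq, hin]
    have : ∑ i, (⟪b i, x⟫ / a i) ^ 2 = ∑ i, ⟪b i, x⟫ * ((a i) ^ 2)⁻¹ * ⟪b i, x⟫ :=
      Finset.sum_congr rfl fun i _ => by rw [div_pow]; ring
    rw [this]

theorem mainTheorem2 (B : Set E3) (hB : IsCenteredEllipsoid B) :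
    -- the matrix `L_B(x)` does not depend on the point `x` of `B`; it is written `L_B = L_B(0)`
    (∀ x ∈ B, dyadicL B x = dyadicL B 0) ∧
    -- averages of eigenvectors of `𝒯_B⁰` belong to the eigenspaces of `L_B`
    (∀ (φ : E3 → E3) (lam : ℝ), MemLp φ 2 (volume.restrict B) → lam ≠ 0 → lam ≠ 1 →
      IsStaticMagnetization B φ (fun x => lam • φ x) → (∫ x in B, φ x) ≠ 0 →
      Matrix.toEuclideanLin (lam • (1 : Matrix (Fin 3) (Fin 3) ℝ) - dyadicL B 0)
        (∫ x in B, φ x) = 0) ∧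
    -- eigenvectors of `L_B`, as constant fields, are eigenvectors of `𝒯_B⁰`
    (∀ (E : E3) (lam : ℝ), E ≠ 0 → Matrix.toEuclideanLin (dyadicL B 0) E = lam • E →
      IsStaticMagnetization B (fun _ => E) (fun _ => lam • E)) := by
  obtain ⟨A, b, α, hA, hb, rfl⟩ := hB.exists_isElliptic
  have hsymm := hA.inner_demag_comm b α hb
  have h0 : (0 : E3) ∈ solidEllipsoid A := by simp [solidEllipsoid]
  refine ⟨fun x hx => ?_, fun φ lam _ _ _ hφ _ => ?_, fun E lam _ hE => ?_⟩
  · ext i j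
    rw [hA.dyadicL_eq_integral hx, hA.dyadicL_eq_integral h0]
  · rw [map_sub, LinearMap.sub_apply, hA.toEuclideanLin_dyadicL h0,
      hA.demag_integral_of_isStaticMagnetization hsymm hφ, sub_eq_zero]
    simp
  · rw [hA.toEuclideanLin_dyadicL h0] at hE
    exact hA.isStaticMagnetization_const hsymm hE
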